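/- Let $n\ge 1$ and write $[m]=\{1,\dots,m\}$. A plane permutation on $[n]$ is a pair $(s,\pi)$ where $s$ is an $n$-cycle on $[n]$ and $\pi$ (the vertical) is an arbitrary permutation of $[n]$; its diagonal is $D=s\pi^{-1}$. Fixed points count as cycles of length $1$. For $\lambda\vdash n$, $0\le m\le n$ and $k\ge 0$, let $p^{\lambda}_{m,k}$ be the number of plane permutations on $[n]$ whose diagonal has cycle type $\lambda$ and whose vertical has exactly $k$ cycles, with the elements of $[m]$ lying in pairwise distinct cycles of the vertical. Let $\ell(\lambda)$ be the number of (positive) parts of $\lambda$. For $\lambda,\mu\vdash n$, write $\mu\rhd_r\lambda$ if $\mu$ is obtained from $\lambda$ by splitting one part into $r$ positive parts, and let $\kappa_{\mu,\lambda}$ be the number of ways of choosing $r$ parts of $\mu$ (parts of equal value being distinguished) such that merging them into one part gives $\lambda$. Then for all $n\ge1$, $\lambda\vdash n$, $0\le m\le n$ and $k\ge 0$ with $n+1-\ell(\lambda)-k>0$, $$ p^{\lambda}_{m,k}=\frac{\displaystyle\sum_{j\ge1}\left[m\binom{k+2j-m}{2j}+\binom{k+2j-m}{2j+1}\right]p^{\lambda}_{m,k+2j}+\sum_{j\ge1}\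 \sum_{\mu\rhd_{2j+1}\lambda}\kappa_{\mu,\lambda}\,p^{\mu}_{m,k}}{n+1-\ell(\lambda)-k}. $$ Both sums have only finitely many nonzero terms; terms of the first sum with $k+2j<m$ are zero, since then $p^{\lambda}_{m,k+2j}=0$. -/

import Mathlib

/-- A plane permutation on `[n]`: a pair `(s, π)` of an `n`-cycle `s` and an arbitrary permutation
`π` of `[n]`. The set `[n] = {1, …, n}` is modelled by `Fin n`, the element `i + 1` being `i`.
`IsCycleOn univ` says that `s` has a single cycle and that it contains every element; for `n = 1`
it admits the identity, the unique `1`-cycle. -/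
@[ext]
structure PlanePermutation (n : ℕ) where
  /-- the upper horizontal -/
  s : Equiv.Perm (Fin n)
  /-- the vertical -/
  vertical : Equiv.Perm (Fin n)
  isCycleOn : s.IsCycleOn Set.univ

namespace PlanePermutation

/-- The diagonal `D = s π⁻¹` of a plane permutation. -/
def diagonal {n : ℕ} (p : PlanePermutation n) : Equiv.Perm (Fin n) :=
  p.s * p.vertical⁻¹

/-- The diagonal sends `π(s_{i-1})` to `s_i = s(s_{i-1})`. -/
theorem diagonal_vertical {n : ℕ} (p : PlanePermutation n) (x : Fin n) :
    p.diagonal (p.vertical x) = p.s x := by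
  simp [diagonal]

instance (n : ℕ) : Finite (PlanePermutation n) :=
  Finite.of_injective (fun p : PlanePermutation n => (p.s, p.vertical)) (by
    intro p q h
    simp only [Prod.mk.injEq] at h
    exact PlanePermutation.ext h.1 h.2)

end PlanePermutation

/-- `D` has cycle type `lam ⊢ n`, where fixed points are counted as parts equal to `1`
(`Equiv.Perm.partition`, unlike `Equiv.Perm.cycleType`, includes them). -/
def HasCycleType {n : ℕ} (D : Equiv.Perm (Fin n)) (lam : n.Partition) : Prop :=
  D.partition.parts = lam.parts

/-- The number of cycles of a permutation, fixed points included. -/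
def numCycles {n : ℕ} (σ : Equiv.Perm (Fin n)) : ℕ :=
  σ.partition.parts.card

/-- The elements of `[m]` lie in pairwise distinct cycles of `σ`. -/
def Separates {n : ℕ} (m : ℕ) (σ : Equiv.Perm (Fin n)) : Prop :=
  ∀ i j : Fin n, i.val < m → j.val < m → σ.SameCycle i j → i = j

/-- The set `U_{m,k}^D` of plane permutations with diagonal `D` whose vertical has `k` cycles and
separates `[m]`. -/
def planePermsWithDiagonal {n : ℕ} (D : Equiv.Perm (Fin n)) (m k : ℕ) :
    Set (PlanePermutation n) :=
  {p | p.diagonal = D ∧ numCycles p.vertical = k ∧ Separates m p.vertical}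

/-- The set `U_{m,k}^λ`, the union of the `U_{m,k}^D` over all `D` of cycle type `λ`. -/
def planePermsWithType {n : ℕ} (lam : n.Partition) (m k : ℕ) : Set (PlanePermutation n) :=
  ⋃ D ∈ {D : Equiv.Perm (Fin n) | HasCycleType D lam}, planePermsWithDiagonal D m k

/-- The number `p^λ_{m,k}` of elements of `U_{m,k}^λ` (a finite set). -/
noncomputable def pNum {n : ℕ} (lam : n.Partition) (m k : ℕ) : ℕ :=
  (planePermsWithType lam m k).ncard

/-- `μ ▷_r λ`: the partition `μ` is obtained from `λ` by splitting one part `a` of `λ` into `r`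
parts (which are positive, being parts of `μ`). -/
def SplitsInto {n : ℕ} (r : ℕ) (mu lam : n.Partition) : Prop :=
  ∃ a ∈ lam.parts, ∃ t : Multiset ℕ, t.card = r ∧ t.sum = a ∧ mu.parts = lam.parts.erase a + t

/-- `κ_{μ,λ}`: the number of ways of merging `r` parts of `μ` into one part so as to obtain `λ`,
where parts of `μ` of equal value are distinguished. (`Multiset.powersetCard r` lists each choice
of `r` of the elements of a multiset separately, also if they have equal values.) -/
def kappa {n : ℕ} (r : ℕ) (mu lam : n.Partition) : ℕ :=
  ((mu.parts.powersetCard r).filter fun t => (mu.parts - t) + {t.sum} = lam.parts).card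

/-- No permutation of `[n]` has more than `n` cycles. -/
theorem pNum_eq_zero_of_lt {n : ℕ} (lam : n.Partition) (m k : ℕ) (h : n < k) :
    pNum lam m k = 0 := by
  have hs : planePermsWithType lam m k = ∅ := by
    ext p
    simp only [planePermsWithType, planePermsWithDiagonal, Set.mem_iUnion, Set.mem_ofPred_eq,
      Set.mem_empty_iff_false, iff_false]
    rintro ⟨D, -, -, hk, -⟩
    have h1 := Multiset.card_nsmul_le_sum (s := p.vertical.partition.parts) (a := 1)
      (fun x hx => p.vertical.partition.parts_pos hx)
    have h2 : p.vertical.partition.parts.sum = n := by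
      simpa using p.vertical.partition.parts_sum
    rw [h2, smul_eq_mul, mul_one] at h1
    unfold numCycles at hk
    omega
  simp [pNum, hs]

/-- A part of a partition of `n` cannot be split into more than `n` parts. -/
theorem not_splitsInto_of_lt {n : ℕ} (r : ℕ) (mu lam : n.Partition) (h : n < r) :
    ¬ SplitsInto r mu lam := by
  rintro ⟨a, -, t, ht, -, hmu⟩
  have h1 := Multiset.card_nsmul_le_sum (s := mu.parts) (a := 1) (fun x hx => mu.parts_pos hx)
  rw [mu.parts_sum, smul_eq_mul, mul_one, hmu, Multiset.card_add] at h1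
  omega

/-! Write a plane permutation as a pair `(D, π)` for which `s = D * π` is a full cycle on `n`
points, and let the distance from `x` to `y` be the number of steps, between `1` and `n`, along `s`.
The way from `x` to `π x` and on to `D (π x) = s x` always takes `n + 1` steps, so the distances
travelled by `π` and by `D` add up to `n(n+1)` (`travel_add_travel`). Each of them counts mergers
(`sum_travel_eq`): with one factor fixed and a condition on the cycles of the other, the total
distance travelled by the latter is `n` times the number of ways to choose the varying factor and an
odd number of its cycles such that the condition holds once these are united to one block. Hence `n
+ 1` times the number of pairs is the number of mergers in `π` plus that in `D`
(`card_factorizations`). Mergers of a single cycle contribute `k + ℓ(λ)` times the number of pairs,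
which moves to the left; those of `2j + 1 ≥ 3` cycles are the two sums.

For one block the claim is `sum_travel_oneCycleOn`: given `E`, the one-cycle permutations `γ` of `B`
with `E * γ` full, weighted by winding number (distance divided by `n`), are as many as the
permutations of `B` with an odd number of cycles. The proof removes a point `v` of `B` and uses
induction. Deleting `v` from `γ` preserves the winding number or lowers it by one. What remains
yields, with a transposition absorbed into `E`, the permutations moving `v`. The units lost are
counted by `card_slice`: exchanging two blocks of the full cycle turns `γ` into a two-cycle
permutation of `B.erase v` with a marked passage of one cycle past `v`. Passages add up to a winding
number, so induction replaces that cycle by an odd number of cycles; with the other cycle and the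
fixed point `v` the total is again odd. -/

section

open Equiv Finset

/-! ### Distances along a full cycle -/

section CyclicDistance

variable {α : Type*} [Fintype α]

/-- The number of steps, between `1` and the number of points, which a full cycle `s` takes from `x`
to `y`. -/
noncomputable def cycDist (s : Perm α) (x y : α) : ℕ :=
  sInf {i | 1 ≤ i ∧ (s ^ i) x = y}

variable {s : Perm α}

theorem pow_apply_eq_pow_apply_of_full (hs : s.IsCycleOn Set.univ) (x : α) {i j : ℕ} :
    (s ^ i) x = (s ^ j) x ↔ i ≡ j [MOD Fintype.card α] := by
  have h : s.IsCycleOn ((univ : Finset α) : Set α) := by simpa using hs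
  exact h.pow_apply_eq_pow_apply (mem_univ x)

theorem exists_pow_eq_of_full (hs : s.IsCycleOn Set.univ) (x y : α) :
    ∃ i, 1 ≤ i ∧ i ≤ Fintype.card α ∧ (s ^ i) x = y := by
  have h : s.IsCycleOn ((univ : Finset α) : Set α) := by simpa using hs
  obtain ⟨i, hi, hxy⟩ := h.exists_pow_eq (mem_univ (s x)) (mem_univ y)
  exact ⟨i + 1, by omega, by simpa using hi, by simpa [pow_succ] using hxy⟩

theorem cycDist_spec (hs : s.IsCycleOn Set.univ) (x y : α) :
    1 ≤ cycDist s x y ∧ (s ^ cycDist s x y) x = y := by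
  obtain ⟨i, hi, -, h⟩ := exists_pow_eq_of_full hs x y
  exact Nat.sInf_mem (s := {i | 1 ≤ i ∧ (s ^ i) x = y}) ⟨i, hi, h⟩

theorem cycDist_pos (hs : s.IsCycleOn Set.univ) (x y : α) : 1 ≤ cycDist s x y :=
  (cycDist_spec hs x y).1

theorem pow_cycDist (hs : s.IsCycleOn Set.univ) (x y : α) : (s ^ cycDist s x y) x = y :=
  (cycDist_spec hs x y).2

theorem cycDist_le (hs : s.IsCycleOn Set.univ) (x y : α) : cycDist s x y ≤ Fintype.card α := by
  obtain ⟨i, hi, hn, h⟩ := exists_pow_eq_of_full hs x y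
  exact (Nat.sInf_le (s := {i | 1 ≤ i ∧ (s ^ i) x = y}) ⟨hi, h⟩).trans hn

theorem eq_of_modEq_of_le {n i j : ℕ} (h : i ≡ j [MOD n]) (hi : 1 ≤ i) (hin : i ≤ n)
    (hj : 1 ≤ j) (hjn : j ≤ n) : i = j := by
  rcases Nat.lt_or_ge i n with h1 | h1 <;> rcases Nat.lt_or_ge j n with h2 | h2
  · exact h.eq_of_lt_of_lt h1 h2
  · obtain rfl : j = n := by omega
    have := Nat.ModEq.trans h (Nat.modEq_zero_iff_dvd.2 dvd_rfl)
    have := this.eq_of_lt_of_lt h1 (by omega)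
    omega
  · obtain rfl : i = n := by omega
    have := Nat.ModEq.trans h.symm (Nat.modEq_zero_iff_dvd.2 dvd_rfl)
    have := this.eq_of_lt_of_lt h2 (by omega)
    omega
  · omega

theorem cycDist_eq (hs : s.IsCycleOn Set.univ) {x y : α} {i : ℕ} (hi : 1 ≤ i)
    (hn : i ≤ Fintype.card α) (h : (s ^ i) x = y) : cycDist s x y = i := by
  refine eq_of_modEq_of_le ?_ (cycDist_pos hs x y) (cycDist_le hs x y) hi hn
  rw [← pow_apply_eq_pow_apply_of_full hs x, h, pow_cycDist hs]

theorem card_pos_of_mem (x : α) : 1 ≤ Fintype.card α := Fintype.card_pos_iff.2 ⟨x⟩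

/-- Only positive numbers of steps are admitted, so a point is at distance `n`, not `0`, from
itself: a fixed point winds once. -/
theorem cycDist_self (hs : s.IsCycleOn Set.univ) (x : α) : cycDist s x x = Fintype.card α := by
  refine cycDist_eq hs (card_pos_of_mem x) le_rfl ?_
  rw [show x = (s ^ 0) x by simp, ← Perm.mul_apply, ← pow_add,
    pow_apply_eq_pow_apply_of_full hs]
  simp [Nat.ModEq]

theorem cycDist_apply (hs : s.IsCycleOn Set.univ) (x : α) : cycDist s x (s x) = 1 :=
  cycDist_eq hs le_rfl (card_pos_of_mem x) (by simp)

theorem cycDist_injective (hs : s.IsCycleOn Set.univ) {x y z : α}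
    (h : cycDist s x y = cycDist s x z) : y = z := by
  rw [← pow_cycDist hs x y, h, pow_cycDist hs]

/-- Both sides agree modulo `n`, and the sum lies between `2` and `2n`, so at most one turn is lost.
-/
theorem cycDist_add (hs : s.IsCycleOn Set.univ) (x y z : α) :
    cycDist s x y + cycDist s y z = cycDist s x z ∨
      cycDist s x y + cycDist s y z = cycDist s x z + Fintype.card α := by
  have h1 := cycDist_pos hs x y
  have h2 := cycDist_pos hs y z
  have h3 := cycDist_le hs x y
  have h4 := cycDist_le hs y z
  have h : (s ^ (cycDist s x y + cycDist s y z)) x = z := by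
    rw [add_comm, pow_add, Perm.mul_apply, pow_cycDist hs, pow_cycDist hs]
  rcases Nat.lt_or_ge (Fintype.card α) (cycDist s x y + cycDist s y z) with h5 | h5
  · right
    have : cycDist s x z = cycDist s x y + cycDist s y z - Fintype.card α := by
      refine cycDist_eq hs (by omega) (by omega) ?_
      refine Eq.trans ?_ h
      rw [pow_apply_eq_pow_apply_of_full hs]
      exact ((Nat.modEq_iff_dvd' (by omega)).2 ⟨1, by omega⟩)
    omega
  · left
    exact (cycDist_eq hs (by omega) h5 h).symm

theorem cycDist_eq_card_iff (hs : s.IsCycleOn Set.univ) {x y : α} :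
    cycDist s x y = Fintype.card α ↔ y = x := by
  rw [← cycDist_self hs x]
  exact ⟨fun h => cycDist_injective hs h, fun h => by rw [h]⟩

theorem cycDist_lt (hs : s.IsCycleOn Set.univ) {x y : α} (h : y ≠ x) :
    cycDist s x y < Fintype.card α :=
  lt_of_le_of_ne (cycDist_le hs x y) fun h' => h ((cycDist_eq_card_iff hs).1 h')

theorem cycDist_add_swap (hs : s.IsCycleOn Set.univ) {x y : α} (h : y ≠ x) :
    cycDist s x y + cycDist s y x = Fintype.card α := by
  have h1 := cycDist_lt hs h
  have h2 := cycDist_lt hs h.symm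
  have h3 := cycDist_add hs x y x
  rw [cycDist_self hs] at h3
  omega

theorem cycDist_apply_right (hs : s.IsCycleOn Set.univ) {x y : α} (h : y ≠ x) :
    cycDist s x (s y) = cycDist s x y + 1 :=
  cycDist_eq hs (by omega) (cycDist_lt hs h) (by rw [pow_succ', Perm.mul_apply, pow_cycDist hs])

omit [Fintype α] in
theorem cycDist_conj (s g : Perm α) (x y : α) :
    cycDist (g * s * g⁻¹) (g x) (g y) = cycDist s x y := by
  unfold cycDist
  congr 1
  ext i
  simp [conj_pow]

/-- A position function which is incremented by `s` witnesses that `s` is a full cycle. -/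
theorem full_of_position {f : α → ℕ} {v : α} (hf : Function.Injective f)
    (hpos : ∀ u, 1 ≤ f u) (hle : ∀ u, f u ≤ Fintype.card α)
    (hsucc : ∀ u, u ≠ v → f (s u) = f u + 1) (hone : f (s v) = 1)
    (hv : f v = Fintype.card α) :
    s.IsCycleOn Set.univ ∧ ∀ u, cycDist s v u = f u := by
  have key : ∀ i, i + 1 ≤ Fintype.card α → f ((s ^ (i + 1)) v) = i + 1 := by
    intro i
    induction i with
    | zero => intro _; simpa using hone
    | succ i ih =>
      intro hi
      rw [pow_succ', Perm.mul_apply, hsucc, ih (by omega)]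
      intro h
      have := ih (by omega)
      rw [h] at this
      omega
  have key' : ∀ u, (s ^ f u) v = u := by
    intro u
    apply hf
    obtain ⟨i, hi⟩ := Nat.exists_eq_add_of_le' (hpos u)
    have := key i (by have := hle u; omega)
    rwa [← hi] at this
  have hs : s.IsCycleOn Set.univ := by
    refine ⟨Set.bijOn_univ.2 s.bijective, fun x _ y _ => ?_⟩
    have h : ∀ u, s.SameCycle v u := fun u => ⟨f u, by simpa using key' u⟩
    exact (h x).symm.trans (h y)
  exact ⟨hs, fun u => cycDist_eq hs (hpos u) (hle u) (key' u)⟩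

/-- Interchanging the two consecutive blocks of a full cycle which follow `v` and end in `a` and
in `p`. -/
theorem blockSwap (hs : s.IsCycleOn Set.univ) {v a p : α} (hp : p ≠ v)
    (hap : cycDist s v a < cycDist s v p) {t : Perm α} (hta : t a = s p) (htp : t p = s v)
    (htv : t v = s a) (ht : ∀ u, u ≠ a → u ≠ p → u ≠ v → t u = s u) :
    t.IsCycleOn Set.univ ∧ ∀ u, cycDist t v u =
      if cycDist s v u ≤ cycDist s v a then cycDist s v u + (cycDist s v p - cycDist s v a)
      else if cycDist s v u ≤ cycDist s v p then cycDist s v u - cycDist s v a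
      else cycDist s v u := by
  have hpn := cycDist_lt hs hp
  have hav : a ≠ v := by
    rintro rfl
    rw [cycDist_self hs] at hap
    omega
  have h1 := cycDist_pos hs v
  have h2 := cycDist_le hs v
  -- Positions seen from `v`: each of the two blocks is shifted by the length of the other, and the
  -- rest, ending in `v` at position `n`, stays.
  refine full_of_position (s := t) (f := fun u =>
      if cycDist s v u ≤ cycDist s v a then cycDist s v u + (cycDist s v p - cycDist s v a)
      else if cycDist s v u ≤ cycDist s v p then cycDist s v u - cycDist s v a
      else cycDist s v u) ?_ ?_ ?_ ?_ ?_ ?_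
  · intro x y hxy
    have hx := h1 x
    have hy := h1 y
    apply cycDist_injective hs (x := v)
    dsimp only at hxy
    split_ifs at hxy <;> omega
  · intro u
    have := h1 u
    split_ifs <;> omega
  · intro u
    have := h2 u
    split_ifs <;> omega
  · intro u hu
    by_cases hua : u = a
    · subst hua
      rw [hta]
      rw [cycDist_apply_right hs hp]
      split_ifs <;> omega
    by_cases hup : u = p
    · subst hup
      rw [htp]
      rw [cycDist_apply hs]
      have := h1 a
      split_ifs <;> omega
    rw [ht u hua hup hu]
    rw [cycDist_apply_right hs hu]
    have hna : cycDist s v u ≠ cycDist s v a := fun h => hua (cycDist_injective hs h)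
    have hnp : cycDist s v u ≠ cycDist s v p := fun h => hup (cycDist_injective hs h)
    split_ifs <;> omega
  · rw [htv]
    rw [cycDist_apply_right hs hav]
    split_ifs <;> omega
  · rw [cycDist_self hs]
    split_ifs <;> omega

end CyclicDistance

/-! ### Splitting and merging cycles by a transposition -/

section SwapMul

variable {α : Type*} [Finite α] [DecidableEq α] {σ : Perm α}

omit [DecidableEq α] in
theorem exists_first_hit {T : α → Prop} {u w : α} (h : σ.SameCycle u w) (hw : T w) :
    ∃ i, 1 ≤ i ∧ T ((σ ^ i) u) ∧ ∀ j, 1 ≤ j → j < i → ¬ T ((σ ^ j) u) := by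
  classical
  have hex : ∃ i, 1 ≤ i ∧ T ((σ ^ i) u) := by
    obtain ⟨i, h1, -, h2⟩ := h.exists_pow_eq''
    exact ⟨i, h1, by rwa [h2]⟩
  exact ⟨Nat.find hex, (Nat.find_spec hex).1, (Nat.find_spec hex).2,
    fun j hj hlt hT => Nat.find_min hex hlt ⟨hj, hT⟩⟩

omit [Finite α] in
theorem swap_mul_pow_apply {x y u : α} {i : ℕ}
    (h : ∀ j, 1 ≤ j → j < i → ¬ ((σ ^ j) u = x ∨ (σ ^ j) u = y)) :
    ∀ j < i, ((swap x y * σ) ^ j) u = (σ ^ j) u := by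
  intro j
  induction j with
  | zero => simp
  | succ j ih =>
    intro hj
    have h' := h (j + 1) (by omega) hj
    push Not at h'
    rw [pow_succ', Perm.mul_apply, ih (by omega), Perm.mul_apply, ← Perm.mul_apply σ, ← pow_succ',
      swap_apply_of_ne_of_ne h'.1 h'.2]

omit [Finite α] in
theorem swap_mul_pow_apply_last {x y u : α} {i : ℕ} (hi : 1 ≤ i)
    (h : ∀ j, 1 ≤ j → j < i → ¬ ((σ ^ j) u = x ∨ (σ ^ j) u = y)) :
    ((swap x y * σ) ^ i) u = swap x y ((σ ^ i) u) := by
  obtain ⟨i, rfl⟩ := Nat.exists_eq_add_of_le' hi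
  rw [pow_succ', Perm.mul_apply, swap_mul_pow_apply h i (by omega), Perm.mul_apply,
    ← Perm.mul_apply σ, ← pow_succ']

theorem sameCycle_swap_mul_or {x y u : α} (h : σ.SameCycle u x) :
    (swap x y * σ).SameCycle u x ∨ (swap x y * σ).SameCycle u y := by
  obtain ⟨i, hi, hT, hlt⟩ := exists_first_hit (T := fun w => w = x ∨ w = y) h (Or.inl rfl)
  have h' := swap_mul_pow_apply_last hi hlt
  rcases hT with hT | hT <;> rw [hT] at h'
  · exact Or.inr ⟨i, by simpa using h'⟩
  · exact Or.inl ⟨i, by simpa using h'⟩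

/-- Multiplication with a transposition merges two cycles. -/
theorem sameCycle_swap_mul_of_not_sameCycle {x y u : α} (hxy : ¬ σ.SameCycle x y)
    (h : σ.SameCycle u x) : (swap x y * σ).SameCycle u y := by
  obtain ⟨i, hi, hT, hlt⟩ := exists_first_hit (T := fun w => w = x ∨ w = y) h (Or.inl rfl)
  have h' := swap_mul_pow_apply_last hi hlt
  rcases hT with hT | hT
  · rw [hT] at h'
    exact ⟨i, by simpa using h'⟩
  · exact absurd (h.symm.trans ⟨i, by simpa using hT⟩) hxy

omit [DecidableEq α] [Finite α] in
theorem pow_mod_apply {x : α} {i : ℕ} (hx : (σ ^ i) x = x) (j : ℕ) :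
    (σ ^ (j % i)) x = (σ ^ j) x := by
  conv_rhs => rw [← Nat.mod_add_div j i, pow_add, Perm.mul_apply, pow_mul]
  rw [Perm.pow_apply_eq_self_of_apply_eq_self hx]

/-- Multiplication with a transposition splits a cycle. -/
theorem not_sameCycle_swap_mul {x y : α} (hne : x ≠ y) (h : σ.SameCycle x y) :
    ¬ (swap x y * σ).SameCycle x y := by
  obtain ⟨i, hi, hT, hlt⟩ := exists_first_hit (T := fun w => w = x ∨ w = y) h (Or.inr rfl)
  have h' := swap_mul_pow_apply_last hi hlt
  have hlow := swap_mul_pow_apply hlt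
  -- If `x` recurred before `y` was met, its cycle would close without `y`.
  have hiy : (σ ^ i) x = y := by
    rcases hT with hT | hT
    · obtain ⟨j, -, hj⟩ := h.exists_pow_eq'
      rw [← pow_mod_apply hT] at hj
      have hlt' := Nat.mod_lt j hi
      rcases Nat.eq_zero_or_pos (j % i) with h0 | h0
      · rw [h0] at hj
        exact absurd hj hne
      · exact absurd (Or.inr hj) (hlt _ h0 hlt')
    · exact hT
  -- The transposition redirects this first hit to `x`, so the new cycle of `x` closes after `i`
  -- steps, without `y`.
  rw [hiy, swap_apply_right] at h'
  intro hs
  obtain ⟨j, -, hj⟩ := hs.exists_pow_eq'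
  rw [← pow_mod_apply h'] at hj
  have hlt' := Nat.mod_lt j hi
  rw [hlow _ hlt'] at hj
  rcases Nat.eq_zero_or_pos (j % i) with h0 | h0
  · rw [h0] at hj
    exact absurd hj hne
  · exact absurd (Or.inr hj) (hlt _ h0 hlt')

end SwapMul

/-! ### Permutations supported in a subset -/

section PermsOn

variable {α : Type*} [Fintype α] [DecidableEq α]

/-- The permutations which fix every point outside of `B`. -/
def permsOn (B : Finset α) : Finset (Perm α) :=
  univ.filter fun γ => ∀ x, x ∉ B → γ x = x

/-- All elements of `B` lie in the same cycle of `γ`. -/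
def OneCycleOn (γ : Perm α) (B : Finset α) : Prop :=
  ∀ x ∈ B, ∀ y ∈ B, γ.SameCycle x y

theorem mem_permsOn {B : Finset α} {γ : Perm α} : γ ∈ permsOn B ↔ ∀ x, x ∉ B → γ x = x := by
  simp [permsOn]

theorem mul_mem_permsOn {B : Finset α} {γ δ : Perm α} (hγ : γ ∈ permsOn B) (hδ : δ ∈ permsOn B) :
    γ * δ ∈ permsOn B := by
  rw [mem_permsOn] at *
  intro x hx
  rw [Perm.mul_apply, hδ x hx, hγ x hx]

theorem inv_mem_permsOn {B : Finset α} {γ : Perm α} (hγ : γ ∈ permsOn B) : γ⁻¹ ∈ permsOn B := by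
  rw [mem_permsOn] at *
  intro x hx
  rw [Perm.inv_eq_iff_eq, hγ x hx]

theorem swap_mem_permsOn {B : Finset α} {x y : α} (hx : x ∈ B) (hy : y ∈ B) :
    swap x y ∈ permsOn B := by
  rw [mem_permsOn]
  intro z hz
  exact swap_apply_of_ne_of_ne (fun h => hz (h ▸ hx)) (fun h => hz (h ▸ hy))

theorem permsOn_mono {B C : Finset α} (h : B ⊆ C) : permsOn B ⊆ permsOn C := by
  intro γ hγ
  rw [mem_permsOn] at *
  exact fun x hx => hγ x fun hB => hx (h hB)

theorem apply_mem_of_mem_permsOn {B : Finset α} {γ : Perm α} (hγ : γ ∈ permsOn B) {x : α} :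
    γ x ∈ B ↔ x ∈ B := by
  rw [mem_permsOn] at hγ
  constructor
  · intro h
    by_contra hx
    rw [hγ x hx] at h
    exact hx h
  · intro h
    by_contra hx
    have := γ.injective (hγ _ hx)
    rw [this] at hx
    exact hx h

theorem mem_permsOn_erase {B : Finset α} {γ : Perm α} {v : α} :
    γ ∈ permsOn (B.erase v) ↔ γ ∈ permsOn B ∧ γ v = v := by
  simp only [mem_permsOn, mem_erase]
  constructor
  · exact fun h => ⟨fun x hx => h x fun h' => hx h'.2, h v fun h' => h'.1 rfl⟩
  · rintro ⟨h1, h2⟩ x hx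
    by_cases hxv : x = v
    · rw [hxv, h2]
    · exact h1 x fun h => hx ⟨hxv, h⟩

/-- Inserting `v` in front of `b` into a cycle. -/
theorem oneCycleOn_swap_mul_iff {B : Finset α} {v b : α} (hv : v ∈ B) (hb : b ∈ B.erase v)
    {γ : Perm α} (hγ : γ ∈ permsOn (B.erase v)) :
    OneCycleOn (swap v b * γ) B ↔ OneCycleOn γ (B.erase v) := by
  have hγv : γ v = v := (mem_permsOn_erase.1 hγ).2
  have hbv : b ≠ v := ne_of_mem_erase hb
  have hfix : ∀ x, γ.SameCycle x v → x = v := fun x h => h.eq_of_right hγv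
  constructor
  · intro h x hx y hy
    have key : ∀ x ∈ B.erase v, γ.SameCycle x b := by
      intro x hx
      have := sameCycle_swap_mul_or (y := b) (h x (mem_of_mem_erase hx) v hv)
      rw [← mul_assoc, swap_mul_self, one_mul] at this
      exact this.resolve_left fun h' => ne_of_mem_erase hx (hfix x h')
    exact (key x hx).trans (key y hy).symm
  · intro h
    have hvb : ¬ γ.SameCycle v b := fun h' => hbv (hfix b h'.symm)
    have key : ∀ x ∈ B, (swap v b * γ).SameCycle x v := by
      intro x hx
      by_cases hxv : x = v
      · rw [hxv]
      · rw [swap_comm]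
        exact sameCycle_swap_mul_of_not_sameCycle (fun h' => hvb h'.symm)
          (h x (mem_erase.2 ⟨hxv, hx⟩) b hb)
    exact fun x hx y hy => (key x hx).trans (key y hy).symm

/-- A permutation moving `v` is determined by `b = γ v` and by `swap v b * γ`, which is `γ` with `v`
deleted from its cycle. -/
theorem sum_permsOn_apply_ne {B : Finset α} {v : α} (hv : v ∈ B) (f : Perm α → ℕ) :
    ∑ γ ∈ permsOn B with γ v ≠ v, f γ =
      ∑ b ∈ B.erase v, ∑ γ ∈ permsOn (B.erase v), f (swap v b * γ) := by
  rw [← sum_product']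
  refine sum_nbij' (fun γ => (γ v, swap v (γ v) * γ)) (fun q => swap v q.1 * q.2) ?_ ?_ ?_ ?_ ?_
  · intro γ hγ
    rw [mem_filter] at hγ
    have h1 := (apply_mem_of_mem_permsOn hγ.1).2 hv
    rw [mem_product, mem_permsOn_erase]
    refine ⟨mem_erase.2 ⟨hγ.2, h1⟩, mul_mem_permsOn (swap_mem_permsOn hv h1) hγ.1, ?_⟩
    simp
  · rintro ⟨b, γ⟩ h
    rw [mem_product, mem_permsOn_erase] at h
    dsimp only at h ⊢
    rw [mem_filter]
    refine ⟨mul_mem_permsOn (swap_mem_permsOn hv (mem_of_mem_erase h.1)) h.2.1, ?_⟩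
    rw [Perm.mul_apply, h.2.2, swap_apply_left]
    exact ne_of_mem_erase h.1
  · intro γ _
    simp [← mul_assoc]
  · rintro ⟨b, γ⟩ h
    rw [mem_product, mem_permsOn_erase] at h
    dsimp only at h ⊢
    rw [Perm.mul_apply, h.2.2, swap_apply_left, ← mul_assoc, swap_mul_self, one_mul]
  · intro γ _
    simp [← mul_assoc]

theorem sum_permsOn_eq_add {B : Finset α} {v : α} (hv : v ∈ B) (f : Perm α → ℕ) :
    ∑ γ ∈ permsOn B, f γ = ∑ γ ∈ permsOn (B.erase v), f γ +
      ∑ b ∈ B.erase v, ∑ γ ∈ permsOn (B.erase v), f (swap v b * γ) := by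
  rw [← sum_permsOn_apply_ne hv, ← sum_filter_add_sum_filter_not (permsOn B) (fun γ => γ v = v)]
  congr 2
  ext γ
  rw [mem_filter, mem_permsOn_erase]

open Classical in
/-- The restriction of `γ` to an invariant set `C`, extended by fixed points. -/
noncomputable def restrictOn (γ : Perm α) (C : Finset α) : Perm α :=
  if h : ∀ x, γ x ∈ C ↔ x ∈ C then Perm.ofSubtype (γ.subtypePerm h) else 1

theorem restrictOn_apply_of_mem {γ : Perm α} {C : Finset α} (h : ∀ x, γ x ∈ C ↔ x ∈ C) {x : α}
    (hx : x ∈ C) : restrictOn γ C x = γ x := by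
  rw [restrictOn, dif_pos h, Perm.ofSubtype_apply_of_mem _ hx]
  rfl

theorem restrictOn_mem_permsOn (γ : Perm α) (C : Finset α) : restrictOn γ C ∈ permsOn C := by
  rw [mem_permsOn]
  intro x hx
  unfold restrictOn
  split_ifs
  · exact Perm.ofSubtype_apply_of_not_mem _ hx
  · rfl

theorem mul_apply_mem_iff {B C : Finset α} {ρ γ : Perm α} (hρ : ρ ∈ permsOn (B \ C))
    (hγ : γ ∈ permsOn C) (x : α) : (ρ * γ) x ∈ C ↔ x ∈ C := by
  rw [Perm.mul_apply, ← apply_mem_of_mem_permsOn hγ (x := x)]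
  rw [mem_permsOn] at hρ
  constructor
  · intro h
    have h2 := hρ (ρ (γ x)) (by simp [h])
    rwa [ρ.injective h2] at h
  · intro h
    rwa [hρ _ (by simp [h])]

/-- A permutation with invariant set `C` is a product of permutations of `C` and its complement. -/
theorem sum_permsOn_invariant {B C : Finset α} (hC : C ⊆ B) (f : Perm α → ℕ) :
    ∑ γ ∈ permsOn B with ∀ x, γ x ∈ C ↔ x ∈ C, f γ =
      ∑ ρ ∈ permsOn (B \ C), ∑ γ ∈ permsOn C, f (ρ * γ) := by
  rw [← sum_product']
  symm
  refine sum_nbij' (fun q => q.1 * q.2)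
    (fun γ => (γ * (restrictOn γ C)⁻¹, restrictOn γ C)) ?_ ?_ ?_ ?_ ?_
  · rintro ⟨ρ, γ⟩ h
    rw [mem_product] at h
    rw [mem_filter]
    exact ⟨mul_mem_permsOn (permsOn_mono sdiff_subset h.1) (permsOn_mono hC h.2),
      mul_apply_mem_iff h.1 h.2⟩
  · intro γ h
    rw [mem_filter] at h
    rw [mem_product]
    refine ⟨?_, restrictOn_mem_permsOn γ C⟩
    rw [mem_permsOn]
    intro x hx
    by_cases hxC : x ∈ C
    · have h1 : (restrictOn γ C)⁻¹ x ∈ C :=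
        (apply_mem_of_mem_permsOn (inv_mem_permsOn (restrictOn_mem_permsOn γ C))).2 hxC
      rw [Perm.mul_apply, ← restrictOn_apply_of_mem h.2 h1]
      exact (restrictOn γ C).apply_symm_apply x
    · rw [Perm.mul_apply, mem_permsOn.1 (inv_mem_permsOn (restrictOn_mem_permsOn γ C)) x hxC]
      exact mem_permsOn.1 h.1 x fun hB => hx (mem_sdiff.2 ⟨hB, hxC⟩)
  · rintro ⟨ρ, γ⟩ h
    rw [mem_product] at h
    have h1 : restrictOn (ρ * γ) C = γ := by
      ext x
      by_cases hx : x ∈ C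
      · rw [restrictOn_apply_of_mem (mul_apply_mem_iff h.1 h.2) hx, Perm.mul_apply,
          mem_permsOn.1 h.1]
        simp [(apply_mem_of_mem_permsOn h.2).2 hx]
      · rw [mem_permsOn.1 (restrictOn_mem_permsOn _ C) x hx, mem_permsOn.1 h.2 x hx]
    simp [h1]
  · intro γ _
    simp
  · intro q _
    rfl

theorem sign_of_oneCycleOn {B : Finset α} (hB : B.Nonempty) {γ : Perm α} (hγ : γ ∈ permsOn B)
    (h : OneCycleOn γ B) : Perm.sign γ = (-1) ^ (B.card + 1) := by
  by_cases h1 : B.card = 1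
  · obtain ⟨v, rfl⟩ := card_eq_one.1 h1
    have : γ = 1 := by
      ext x
      by_cases hx : x = v
      · subst hx
        simpa using (apply_mem_of_mem_permsOn hγ).2 (mem_singleton_self x)
      · exact mem_permsOn.1 hγ x (by simpa using hx)
    simp [this]
  · have hnt : (B : Set α).Nontrivial := by
      change B.Nontrivial
      rw [← one_lt_card_iff_nontrivial]
      have := hB.card_pos
      omega
    have hcyc : γ.IsCycleOn (B : Set α) :=
      ⟨⟨fun x hx => (apply_mem_of_mem_permsOn hγ).2 hx, γ.injective.injOn, fun x hx =>
        ⟨γ⁻¹ x, (apply_mem_of_mem_permsOn (inv_mem_permsOn hγ)).2 hx, by simp⟩⟩,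
        fun x hx y hy => h x hx y hy⟩
    have hsupp : γ.support = B := by
      ext x
      rw [Perm.mem_support]
      constructor
      · intro hx
        by_contra hxB
        exact hx (mem_permsOn.1 hγ x hxB)
      · intro hx
        exact hcyc.apply_ne hnt hx
    have hc : γ.IsCycle := Perm.isCycle_iff_exists_isCycleOn.2 ⟨B, hnt, hcyc, fun x hx => by
      rw [← hsupp]; exact Perm.mem_support.2 hx⟩
    rw [hc.sign, hsupp, pow_succ]
    simp

end PermsOn

/-! ### Travelled distance and winding number -/

section Travel

variable {α : Type*} [Fintype α]

/-- The total number of steps along the full cycle `s` needed to go from each `x ∈ B` to `γ x`. -/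
noncomputable def travel (s γ : Perm α) (B : Finset α) : ℕ :=
  ∑ x ∈ B, cycDist s x (γ x)

/-- `γ` winds around the full cycle `s` as many times as it passes the point `v`. -/
theorem travel_eq_card_mul {s : Perm α} (hs : s.IsCycleOn Set.univ) {γ : Perm α} {C : Finset α}
    (hC : ∀ x, γ x ∈ C ↔ x ∈ C) (v : α) :
    travel s γ C =
      Fintype.card α * #{x ∈ C | cycDist s v (γ x) ≤ cycDist s v x} := by
  -- The position seen from `v` grows by the number of steps, less `n` when the way wraps around at
  -- `v`. The positions of `x` and `γ x` cancel in the sum, since `γ` permutes `C`.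
  have h : ∀ x ∈ C, cycDist s v x + cycDist s x (γ x) = cycDist s v (γ x) +
      Fintype.card α * if cycDist s v (γ x) ≤ cycDist s v x then 1 else 0 := by
    intro x _
    have h1 := cycDist_add hs v x (γ x)
    have h2 := cycDist_pos hs x (γ x)
    have h3 := cycDist_le hs x (γ x)
    split_ifs <;> omega
  have h' := sum_congr rfl h
  rw [sum_add_distrib, sum_add_distrib, ← mul_sum, sum_boole,
    sum_equiv γ (t := C) (g := fun x => cycDist s v x)
      (fun x => (hC x).symm) (fun _ _ => rfl)] at h'
  unfold travel
  simp only [Nat.cast_id] at h'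
  omega

omit [Fintype α] in
theorem travel_congr {s γ δ : Perm α} {C : Finset α} (h : ∀ x ∈ C, γ x = δ x) :
    travel s γ C = travel s δ C :=
  sum_congr rfl fun x hx => by rw [h x hx]

variable [DecidableEq α]

/-- The effect on the travelled distance of deleting a point `v` from a permutation. -/
theorem travel_delete {s : Perm α} (hs : s.IsCycleOn Set.univ) {γ : Perm α} {B : Finset α} {v : α}
    (hγ : γ ∈ permsOn B) (hv : v ∈ B) (hne : γ v ≠ v) :
    travel s γ B = travel s (swap v (γ v) * γ) (B.erase v) + Fintype.card α *
      if Fintype.card α < cycDist s (γ⁻¹ v) v + cycDist s v (γ v) then 1 else 0 := by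
  have ha : γ⁻¹ v ∈ B.erase v := by
    rw [mem_erase]
    refine ⟨fun h => hne ?_, (apply_mem_of_mem_permsOn (inv_mem_permsOn hγ)).2 hv⟩
    exact (Perm.inv_eq_iff_eq.1 h).symm
  unfold travel
  rw [← add_sum_erase _ _ hv, ← add_sum_erase _ _ ha, ← add_sum_erase _ _ ha]
  have h1 : ∑ x ∈ (B.erase v).erase (γ⁻¹ v), cycDist s x ((swap v (γ v) * γ) x) =
      ∑ x ∈ (B.erase v).erase (γ⁻¹ v), cycDist s x (γ x) := by
    refine sum_congr rfl fun x hx => ?_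
    rw [mem_erase, mem_erase] at hx
    rw [Perm.mul_apply, swap_apply_of_ne_of_ne]
    · exact fun h => hx.1 (Perm.eq_inv_iff_eq.2 h)
    · exact fun h => hx.2.1 (γ.injective h)
  have h2 : γ (γ⁻¹ v) = v := γ.apply_symm_apply v
  rw [h1, Perm.mul_apply, h2, swap_apply_left]
  -- Only the way from `γ⁻¹ v` through `v` to `γ v` changes; the direct way is equally long or one
  -- turn shorter.
  have h3 := cycDist_add hs (γ⁻¹ v) v (γ v)
  have h4 := cycDist_pos hs (γ⁻¹ v) (γ v)
  have h5 := cycDist_le hs (γ⁻¹ v) (γ v)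
  split_ifs <;> omega

/-- The last element of `B` before `v` on the full cycle `E * γ` is `γ⁻¹ z`, where `z` does not
depend on `γ`. -/
theorem exists_last_before (E : Perm α) {B : Finset α} {v : α} (hv : v ∈ B) :
    ∃ z ∈ B, ∀ γ ∈ permsOn B, (E * γ).IsCycleOn Set.univ →
      (∀ u ∈ B, u ≠ v → cycDist (E * γ) v u ≤ cycDist (E * γ) v (γ⁻¹ z)) ∧
      (γ⁻¹ z = v → ∀ u ∈ B, u = v) := by
  -- `z` is the first point of `B` on the backward orbit of `v` under `E`. Off `B` the cycle `E * γ`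
  -- moves as `E`, so from `γ⁻¹ z` it meets no point of `B` until it reaches `v`.
  obtain ⟨r, hr, hz, hlt⟩ := exists_first_hit (σ := E⁻¹) (T := fun w => w ∈ B)
    (Perm.SameCycle.refl _ v) hv
  refine ⟨(E⁻¹ ^ r) v, hz, fun γ hγ hs => ?_⟩
  set z := (E⁻¹ ^ r) v with hzdef
  have hE : ∀ j ≤ r, (E ^ j) z = (E⁻¹ ^ (r - j)) v := by
    intro j hj
    rw [hzdef, ← Perm.mul_apply]
    congr 1
    rw [inv_pow, inv_pow, ← zpow_natCast, ← zpow_natCast, ← zpow_natCast, ← zpow_neg, ← zpow_neg,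
      ← zpow_add, Nat.cast_sub hj]
    congr 1
    ring
  have hpow : ∀ j, j + 1 ≤ r → ((E * γ) ^ (j + 1)) (γ⁻¹ z) = (E ^ (j + 1)) z := by
    intro j
    induction j with
    | zero => intro _; simp
    | succ j ih =>
      intro hj
      rw [pow_succ', Perm.mul_apply, ih (by omega), Perm.mul_apply, mem_permsOn.1 hγ,
        ← Perm.mul_apply, ← pow_succ']
      rw [hE _ (by omega)]
      exact hlt _ (by omega) (by omega)
  have hnot : ∀ j, 1 ≤ j → j < r → ((E * γ) ^ j) (γ⁻¹ z) ∉ B := by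
    intro j hj hjr
    obtain ⟨j, rfl⟩ := Nat.exists_eq_add_of_le' hj
    rw [hpow j (by omega), hE _ (by omega)]
    exact hlt _ (by omega) (by omega)
  have hlast : ((E * γ) ^ r) (γ⁻¹ z) = v := by
    obtain ⟨j, rfl⟩ := Nat.exists_eq_add_of_le' hr
    rw [hpow j (by omega), hE _ (by omega)]
    simp
  have hle : cycDist (E * γ) (γ⁻¹ z) v ≤ r := Nat.sInf_le ⟨hr, hlast⟩
  have key : ∀ u ∈ B, u ≠ v → cycDist (E * γ) (γ⁻¹ z) v ≤ cycDist (E * γ) (γ⁻¹ z) u := by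
    intro u hu huv
    by_contra hcon
    refine hnot (cycDist (E * γ) (γ⁻¹ z) u) (cycDist_pos hs _ u) (by omega) ?_
    rwa [pow_cycDist hs]
  constructor
  · intro u hu huv
    have h1 := key u hu huv
    have h2 := cycDist_add hs v (γ⁻¹ z) u
    have h3 := cycDist_add hs v (γ⁻¹ z) v
    have h4 := cycDist_le hs v u
    have h5 := cycDist_self hs v
    have h6 := cycDist_pos hs (γ⁻¹ z) v
    have h7 := cycDist_lt hs huv
    have h8 := cycDist_le hs (γ⁻¹ z) u
    have h9 := cycDist_pos hs v (γ⁻¹ z)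
    have h10 := cycDist_le hs v (γ⁻¹ z)
    have h11 := cycDist_le hs (γ⁻¹ z) v
    by_contra hcon
    omega
  · intro hzv u hu
    by_contra huv
    have h1 := key u hu huv
    rw [hzv, cycDist_self hs] at h1
    have := cycDist_lt hs huv
    omega

end Travel

/-! ### The block exchange for a lost turn -/

section Merge

variable {α : Type*} [Fintype α] [DecidableEq α]

open Classical in
/-- One-cycle permutations of `B` whose neighbours of `v` are in cyclic order correspond to
two-cycle permutations of `B.erase v` with a marked passage of the second cycle. -/
theorem card_slice (E : Perm α) {B : Finset α} {v z : α} (hv : v ∈ B) (hz : z ∈ B) (hzv : z ≠ v)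
    (hlast : ∀ γ ∈ permsOn B, (E * γ).IsCycleOn Set.univ →
      (∀ u ∈ B, u ≠ v → cycDist (E * γ) v u ≤ cycDist (E * γ) v (γ⁻¹ z)) ∧
      (γ⁻¹ z = v → ∀ u ∈ B, u = v)) :
    #{γ ∈ permsOn B | OneCycleOn γ B ∧ (E * γ).IsCycleOn Set.univ ∧
        Fintype.card α < cycDist (E * γ) (γ⁻¹ v) v + cycDist (E * γ) v (γ v)} =
      #{q ∈ permsOn (B.erase v) ×ˢ B.erase v | (E * q.1).IsCycleOn Set.univ ∧
        ¬ q.1.SameCycle z q.2 ∧ (∀ u ∈ B.erase v, q.1.SameCycle u z ∨ q.1.SameCycle u q.2) ∧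
        cycDist (E * q.1) v (q.1 q.2) ≤ cycDist (E * q.1) v q.2} := by
  have hzB' : z ∈ B.erase v := mem_erase.2 ⟨hzv, hz⟩
  -- Let `a = γ⁻¹ v`, `b = γ v`, `p = γ⁻¹ z`. Deleting `v` and splitting the cycle at `z` and `b`
  -- gives `a ↦ z` and `p ↦ b`, with `p` marked. On the full cycle this exchanges the blocks after
  -- `v` ending in `a` and in `p`; the inverse exchanges them back.
  refine card_nbij' (fun γ => (swap z (γ v) * (swap v (γ v) * γ), γ⁻¹ z))
    (fun q => swap v (q.1 q.2) * (swap z (q.1 q.2) * q.1)) ?_ ?_ ?_ ?_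
  · intro γ hγ
    obtain ⟨hγB, hone, hfull, hcond⟩ := mem_filter.1 hγ
    obtain ⟨hl1, hl2⟩ := hlast γ hγB hfull
    have hbv : γ v ≠ v := by
      intro h
      exact hzv ((hone z hz v hv).eq_of_right h)
    have hb : γ v ∈ B := (apply_mem_of_mem_permsOn hγB).2 hv
    have hbB' : γ v ∈ B.erase v := mem_erase.2 ⟨hbv, hb⟩
    have hpv : γ⁻¹ z ≠ v := fun h => hzv (hl2 h z hz)
    have hp : γ⁻¹ z ∈ B := (apply_mem_of_mem_permsOn (inv_mem_permsOn hγB)).2 hz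
    have hγp : γ (γ⁻¹ z) = z := γ.apply_symm_apply z
    have hγa : γ (γ⁻¹ v) = v := γ.apply_symm_apply v
    have hzb : z ≠ γ v := fun h => hpv (by rw [h]; exact γ.symm_apply_apply v)
    have hav : γ⁻¹ v ≠ v := fun h => hbv (by rw [h] at hγa; exact hγa)
    have hγ' : swap v (γ v) * γ ∈ permsOn (B.erase v) := by
      rw [mem_permsOn_erase]
      exact ⟨mul_mem_permsOn (swap_mem_permsOn hv hb) hγB, by simp⟩
    have hone' : OneCycleOn (swap v (γ v) * γ) (B.erase v) := by
      rw [← oneCycleOn_swap_mul_iff hv hbB' hγ', ← mul_assoc, swap_mul_self, one_mul]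
      exact hone
    have hpb : (swap z (γ v) * (swap v (γ v) * γ)) (γ⁻¹ z) = γ v := by
      rw [Perm.mul_apply, Perm.mul_apply, hγp, swap_apply_of_ne_of_ne hzv hzb, swap_apply_left]
    have hsplit := not_sameCycle_swap_mul hzb (hone' z hzB' _ hbB')
    have hpb' : (swap z (γ v) * (swap v (γ v) * γ)).SameCycle (γ⁻¹ z) (γ v) :=
      ⟨1, by simpa using hpb⟩
    -- As the distances between `v` and `γ⁻¹ v` add up to `n`, a turn is lost exactly when `γ v`
    -- comes after `γ⁻¹ v` seen from `v`, that is, lies in the second block.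
    have hlt : cycDist (E * γ) v (γ⁻¹ v) < cycDist (E * γ) v (γ v) := by
      have := cycDist_add_swap hfull hav
      omega
    have hble := hl1 _ hb hbv
    obtain ⟨hfull', hpos⟩ := blockSwap hfull (v := v) (a := γ⁻¹ v) (p := γ⁻¹ z) hpv
      (by omega) (t := E * (swap z (γ v) * (swap v (γ v) * γ)))
      (by simp) (by rw [Perm.mul_apply E, hpb, Perm.mul_apply])
      (by simp [swap_apply_of_ne_of_ne hzv.symm hbv.symm])
      (by
        intro u h1 h2 h3
        have h1' : γ u ≠ v := fun h => h1 (Perm.eq_inv_iff_eq.2 h)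
        have h2' : γ u ≠ z := fun h => h2 (Perm.eq_inv_iff_eq.2 h)
        have h3' : γ u ≠ γ v := fun h => h3 (γ.injective h)
        simp [swap_apply_of_ne_of_ne h1' h3', swap_apply_of_ne_of_ne h2' h3'])
    have goal : (E * (swap z (γ v) * (swap v (γ v) * γ))).IsCycleOn Set.univ ∧
        ¬ (swap z (γ v) * (swap v (γ v) * γ)).SameCycle z (γ⁻¹ z) ∧
        (∀ u ∈ B.erase v, (swap z (γ v) * (swap v (γ v) * γ)).SameCycle u z ∨
          (swap z (γ v) * (swap v (γ v) * γ)).SameCycle u (γ⁻¹ z)) ∧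
        cycDist (E * (swap z (γ v) * (swap v (γ v) * γ))) v
          ((swap z (γ v) * (swap v (γ v) * γ)) (γ⁻¹ z)) ≤
        cycDist (E * (swap z (γ v) * (swap v (γ v) * γ))) v (γ⁻¹ z) := by
      refine ⟨hfull', fun h => hsplit (h.trans hpb'), fun u hu => ?_, ?_⟩
      · exact (sameCycle_swap_mul_or (hone' u hu z hzB')).imp_right fun h => h.trans hpb'.symm
      · rw [hpb, hpos, hpos]
        split_ifs <;> omega
    rw [mem_coe, mem_filter, mem_product]
    exact ⟨⟨mul_mem_permsOn (swap_mem_permsOn hzB' hbB') hγ', mem_erase.2 ⟨hpv, hp⟩⟩, goal⟩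
  · rintro ⟨δ, p⟩ hq
    rw [mem_coe, mem_filter, mem_product] at hq
    dsimp only at hq ⊢
    obtain ⟨⟨hδ, hp⟩, hfull, hnot, htwo, hcond⟩ := hq
    have hδB := (mem_permsOn_erase.1 hδ).1
    have hδv := (mem_permsOn_erase.1 hδ).2
    have hbB' : δ p ∈ B.erase v := (apply_mem_of_mem_permsOn hδ).2 hp
    have hbv := ne_of_mem_erase hbB'
    have hpb : δ.SameCycle p (δ p) := ⟨1, by simp⟩
    have hnot' : ¬ δ.SameCycle z (δ p) := fun h => hnot (h.trans hpb.symm)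
    have hzb : z ≠ δ p := fun h => hnot' (h ▸ Perm.SameCycle.refl _ _)
    have hδa : δ (δ⁻¹ z) = z := δ.apply_symm_apply z
    have haz : δ.SameCycle (δ⁻¹ z) z := ⟨1, by simp⟩
    have hav : δ⁻¹ z ≠ v := fun h => hzv (by rw [h, hδv] at hδa; exact hδa.symm)
    have hpa : p ≠ δ⁻¹ z := fun h => hnot (h ▸ haz.symm)
    have hpv := ne_of_mem_erase hp
    -- For `δ`, the last point of `B` before `v` is `δ⁻¹ z`, so the marked point `p` ends the first
    -- block.
    have hlt : cycDist (E * δ) v p < cycDist (E * δ) v (δ⁻¹ z) :=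
      lt_of_le_of_ne ((hlast δ hδB hfull).1 p (mem_of_mem_erase hp) hpv)
        fun h => hpa (cycDist_injective hfull h)
    have hδ' : swap z (δ p) * δ ∈ permsOn (B.erase v) :=
      mul_mem_permsOn (swap_mem_permsOn hzB' hbB') hδ
    have hone' : OneCycleOn (swap z (δ p) * δ) (B.erase v) := by
      have hzb' : (swap z (δ p) * δ).SameCycle z (δ p) :=
        sameCycle_swap_mul_of_not_sameCycle hnot' (Perm.SameCycle.refl _ _)
      have key : ∀ u ∈ B.erase v, (swap z (δ p) * δ).SameCycle u z := by
        intro u hu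
        rcases htwo u hu with h | h
        · exact (sameCycle_swap_mul_of_not_sameCycle hnot' h).trans hzb'.symm
        · rw [swap_comm]
          exact sameCycle_swap_mul_of_not_sameCycle (fun h => hnot' h.symm) (h.trans hpb)
      exact fun x hx y hy => (key x hx).trans (key y hy).symm
    set γ := swap v (δ p) * (swap z (δ p) * δ) with hγ
    have hγB : γ ∈ permsOn B :=
      mul_mem_permsOn (swap_mem_permsOn hv (mem_of_mem_erase hbB')) (mem_permsOn_erase.1 hδ').1
    have hone : OneCycleOn γ B := (oneCycleOn_swap_mul_iff hv hbB' hδ').2 hone'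
    have hγv : γ v = δ p := by
      rw [hγ, Perm.mul_apply, Perm.mul_apply, hδv, swap_apply_of_ne_of_ne hzv.symm hbv.symm,
        swap_apply_left]
    have hγp : γ p = z := by
      rw [hγ, Perm.mul_apply, Perm.mul_apply, swap_apply_right, swap_apply_of_ne_of_ne hzv hzb]
    have hγa : γ (δ⁻¹ z) = v := by
      rw [hγ, Perm.mul_apply, Perm.mul_apply, hδa, swap_apply_left, swap_apply_right]
    have hγa' : γ⁻¹ v = δ⁻¹ z := Perm.inv_eq_iff_eq.2 hγa.symm
    obtain ⟨hfull', hpos⟩ := blockSwap hfull (v := v) (a := p) (p := δ⁻¹ z) hav hlt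
      (t := E * γ) (by rw [Perm.mul_apply E, Perm.mul_apply E, hγp, hδa])
      (by rw [Perm.mul_apply E, Perm.mul_apply E, hγa, hδv])
      (by rw [Perm.mul_apply E, Perm.mul_apply E, hγv])
      (by
        intro u h1 h2 h3
        have h1' : δ u ≠ δ p := fun h => h1 (δ.injective h)
        have h2' : δ u ≠ z := fun h => h2 (Perm.eq_inv_iff_eq.2 h)
        have h3' : δ u ≠ v := fun h => h3 (δ.injective (h.trans hδv.symm))
        rw [hγ, Perm.mul_apply, Perm.mul_apply, Perm.mul_apply, Perm.mul_apply,
          swap_apply_of_ne_of_ne h2' h1', swap_apply_of_ne_of_ne h3' h1'])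
    rw [mem_coe, mem_filter]
    refine ⟨hγB, hone, hfull', ?_⟩
    rw [hγa', hγv]
    have h1 := cycDist_add_swap hfull' hav
    have h2 := hpos (δ⁻¹ z)
    have h3 := hpos (δ p)
    have h4 := cycDist_pos hfull v (δ p)
    rw [if_neg (by omega), if_pos le_rfl] at h2
    rw [if_pos hcond] at h3
    omega
  · intro γ hγ
    obtain ⟨hγB, hone, hfull, hcond⟩ := mem_filter.1 hγ
    obtain ⟨hl1, hl2⟩ := hlast γ hγB hfull
    have hγp : γ (γ⁻¹ z) = z := γ.apply_symm_apply z
    have hpv : γ⁻¹ z ≠ v := fun h => hzv (hl2 h z hz)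
    have hzb : z ≠ γ v := fun h => hpv (by rw [h]; exact γ.symm_apply_apply v)
    have hpb : (swap z (γ v) * (swap v (γ v) * γ)) (γ⁻¹ z) = γ v := by
      rw [Perm.mul_apply, Perm.mul_apply, hγp, swap_apply_of_ne_of_ne hzv hzb, swap_apply_left]
    dsimp only
    rw [hpb, ← mul_assoc (swap z (γ v)), swap_mul_self, one_mul, ← mul_assoc, swap_mul_self,
      one_mul]
  · rintro ⟨δ, p⟩ hq
    rw [mem_coe, mem_filter, mem_product] at hq
    dsimp only at hq ⊢
    obtain ⟨⟨hδ, hp⟩, hfull, hnot, htwo, hcond⟩ := hq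
    have hδv := (mem_permsOn_erase.1 hδ).2
    have hbv := ne_of_mem_erase ((apply_mem_of_mem_permsOn hδ).2 hp)
    have hzb : z ≠ δ p := fun h => hnot (by rw [h]; exact ⟨-1, by simp⟩)
    have hγv : (swap v (δ p) * (swap z (δ p) * δ)) v = δ p := by
      rw [Perm.mul_apply, Perm.mul_apply, hδv, swap_apply_of_ne_of_ne hzv.symm hbv.symm,
        swap_apply_left]
    have hγp : (swap v (δ p) * (swap z (δ p) * δ)) p = z := by
      rw [Perm.mul_apply, Perm.mul_apply, swap_apply_right, swap_apply_of_ne_of_ne hzv hzb]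
    rw [hγv, Prod.mk.injEq]
    refine ⟨?_, Perm.inv_eq_iff_eq.2 hγp.symm⟩
    rw [← mul_assoc (swap v (δ p)), swap_mul_self, one_mul, ← mul_assoc, swap_mul_self, one_mul]

end Merge

/-! ### The winding identity for one block -/

section Main

variable {α : Type*}

theorem sameCycle_of_eqOn [Finite α] {γ δ : Perm α} {C : Finset α} (hC : ∀ x, γ x ∈ C ↔ x ∈ C)
    (h : ∀ x ∈ C, γ x = δ x) {x y : α} (hx : x ∈ C) (hxy : γ.SameCycle x y) :
    y ∈ C ∧ δ.SameCycle x y := by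
  obtain ⟨i, rfl⟩ := hxy.exists_nat_pow_eq
  clear hxy
  induction i with
  | zero => exact ⟨hx, Perm.SameCycle.refl _ _⟩
  | succ i ih =>
    rw [pow_succ', Perm.mul_apply]
    refine ⟨(hC _).2 ih.1, ?_⟩
    rw [h _ ih.1]
    exact Perm.sameCycle_apply_right.2 ih.2

theorem oneCycleOn_congr [Finite α] {γ δ : Perm α} {C : Finset α} (hC : ∀ x, γ x ∈ C ↔ x ∈ C)
    (h : ∀ x ∈ C, γ x = δ x) (hone : OneCycleOn γ C) : OneCycleOn δ C :=
  fun x hx y hy => (sameCycle_of_eqOn hC h hx (hone x hx y hy)).2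

variable [Fintype α] [DecidableEq α]

theorem mul_apply_eq_right {B C : Finset α} {ρ γ : Perm α} (hρ : ρ ∈ permsOn (B \ C))
    (hγ : γ ∈ permsOn C) {x : α} (hx : x ∈ C) : (ρ * γ) x = γ x := by
  rw [Perm.mul_apply, mem_permsOn.1 hρ]
  simp [(apply_mem_of_mem_permsOn hγ).2 hx]

theorem mul_apply_eq_left {C : Finset α} {ρ γ : Perm α}
    (hγ : γ ∈ permsOn C) {x : α} (hx : x ∉ C) : (ρ * γ) x = ρ x := by
  rw [Perm.mul_apply, mem_permsOn.1 hγ x hx]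

theorem oneCycleOn_mul_right_iff {B C : Finset α} {ρ γ : Perm α} (hρ : ρ ∈ permsOn (B \ C))
    (hγ : γ ∈ permsOn C) : OneCycleOn (ρ * γ) C ↔ OneCycleOn γ C :=
  ⟨oneCycleOn_congr (mul_apply_mem_iff hρ hγ) fun _ hx => mul_apply_eq_right hρ hγ hx,
    oneCycleOn_congr (fun _ => apply_mem_of_mem_permsOn hγ) fun _ hx =>
      (mul_apply_eq_right hρ hγ hx).symm⟩

theorem oneCycleOn_mul_left_iff {B C : Finset α} {ρ γ : Perm α} (hρ : ρ ∈ permsOn (B \ C))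
    (hγ : γ ∈ permsOn C) : OneCycleOn (ρ * γ) (B \ C) ↔ OneCycleOn ρ (B \ C) := by
  have h : ∀ x ∈ B \ C, (ρ * γ) x = ρ x := fun x hx => mul_apply_eq_left hγ (mem_sdiff.1 hx).2
  refine ⟨oneCycleOn_congr (fun x => ?_) h,
    oneCycleOn_congr (fun _ => apply_mem_of_mem_permsOn hρ) fun x hx => (h x hx).symm⟩
  rw [Perm.mul_apply, apply_mem_of_mem_permsOn hρ]
  by_cases hx : x ∈ C
  · have := (apply_mem_of_mem_permsOn hγ).2 hx
    simp [hx, this]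
  · rw [mem_permsOn.1 hγ x hx]

open Classical in
-- The permutations are sorted by the complement `C` in `A` of the cycle of `z`; excluding one-cycle
-- permutations makes `C` nonempty.
theorem card_permsOn_eq_sum (A : Finset α) {z : α} (hz : z ∈ A) (P : Perm α → Prop)
    [DecidablePred P]
    (hP : ∀ γ ∈ permsOn A, P γ → ¬ OneCycleOn γ A) :
    #{γ ∈ permsOn A | P γ} =
      ∑ C ∈ (A.erase z).powerset with C.Nonempty,
        ∑ γ ∈ permsOn A with ∀ x, γ x ∈ C ↔ x ∈ C,
          if OneCycleOn γ (A \ C) ∧ P γ then 1 else 0 := by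
  rw [card_eq_sum_card_fiberwise (f := fun γ => {u ∈ A | ¬ γ.SameCycle u z})
    (t := {C ∈ (A.erase z).powerset | C.Nonempty})]
  · refine sum_congr rfl fun C hC => ?_
    rw [mem_filter, mem_powerset] at hC
    rw [← sum_filter, sum_const, smul_eq_mul, mul_one]
    congr 1
    ext γ
    simp only [mem_filter]
    have hzC : z ∉ C := fun h => by simpa using hC.1 h
    constructor
    · rintro ⟨⟨h1, h2⟩, rfl⟩
      refine ⟨⟨h1, fun x => ?_⟩, ?_, h2⟩
      · rw [mem_filter, mem_filter, apply_mem_of_mem_permsOn h1, Perm.sameCycle_apply_left]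
      · have key : ∀ x ∈ A \ {u ∈ A | ¬ γ.SameCycle u z}, γ.SameCycle x z := by
          intro x hx
          rw [mem_sdiff, mem_filter, not_and, not_not] at hx
          exact hx.2 hx.1
        exact fun x hx y hy => (key x hx).trans (key y hy).symm
    · rintro ⟨⟨h1, h2⟩, h3, h4⟩
      refine ⟨⟨h1, h4⟩, ?_⟩
      ext u
      rw [mem_filter]
      constructor
      · rintro ⟨hu, hus⟩
        by_contra huC
        exact hus (h3 u (mem_sdiff.2 ⟨hu, huC⟩) z (mem_sdiff.2 ⟨hz, hzC⟩))
      · intro hu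
        exact ⟨mem_of_mem_erase (hC.1 hu), fun h =>
          hzC (sameCycle_of_eqOn h2 (fun _ _ => rfl) hu h).1⟩
  · intro γ hγ
    rw [mem_coe, mem_filter] at hγ
    rw [mem_coe, mem_filter, mem_powerset]
    constructor
    · intro u hu
      rw [mem_filter] at hu
      exact mem_erase.2 ⟨fun h => hu.2 (h ▸ Perm.SameCycle.refl _ _), hu.1⟩
    · by_contra hne
      rw [not_nonempty_iff_eq_empty, filter_eq_empty_iff] at hne
      refine hP γ hγ.1 hγ.2 fun x hx y hy => ?_
      exact (not_not.1 (hne hx)).trans (not_not.1 (hne hy)).symm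

open Classical in
-- Here `C` is the cycle of the marked point, so the cycle of `z` fills `A \ C`.
theorem card_marked_eq_sum (A : Finset α) {z : α} (hz : z ∈ A) (P : Perm α → Prop)
    [DecidablePred P]
    (R : Perm α → α → Prop) [∀ γ, DecidablePred (R γ)] :
    #{q ∈ permsOn A ×ˢ A | P q.1 ∧ ¬ q.1.SameCycle z q.2 ∧
        (∀ u ∈ A, q.1.SameCycle u z ∨ q.1.SameCycle u q.2) ∧ R q.1 q.2} =
      ∑ C ∈ (A.erase z).powerset with C.Nonempty,
        ∑ γ ∈ permsOn A with ∀ x, γ x ∈ C ↔ x ∈ C,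
          if OneCycleOn γ (A \ C) ∧ OneCycleOn γ C ∧ P γ then #{p ∈ C | R γ p} else 0 := by
  rw [card_eq_sum_card_fiberwise (f := fun q => {u ∈ A | q.1.SameCycle u q.2})
    (t := {C ∈ (A.erase z).powerset | C.Nonempty})]
  · refine sum_congr rfl fun C hC => ?_
    rw [mem_filter, mem_powerset] at hC
    have hzC : z ∉ C := fun h => by simpa using hC.1 h
    rw [← sum_filter, ← card_sigma]
    refine card_nbij' (fun q => ⟨q.1, q.2⟩) (fun q => (q.1, q.2)) ?_ ?_ (fun _ _ => rfl)
      (fun _ _ => rfl)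
    · rintro ⟨γ, p⟩ hq
      simp only [mem_coe, mem_filter, mem_product] at hq
      obtain ⟨⟨⟨h1, hp⟩, h2, h3, h4, h5⟩, rfl⟩ := hq
      simp only [mem_coe, mem_sigma, mem_filter]
      refine ⟨⟨⟨h1, fun x => ?_⟩, ?_, ?_, h2⟩, ⟨hp, Perm.SameCycle.refl _ _⟩, h5⟩
      · rw [apply_mem_of_mem_permsOn h1, Perm.sameCycle_apply_left]
      · have key : ∀ x ∈ A \ {u ∈ A | γ.SameCycle u p}, γ.SameCycle x z := by
          intro x hx
          rw [mem_sdiff, mem_filter, not_and] at hx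
          exact (h4 x hx.1).resolve_right (hx.2 hx.1)
        exact fun x hx y hy => (key x hx).trans (key y hy).symm
      · intro x hx y hy
        rw [mem_filter] at hx hy
        exact hx.2.trans hy.2.symm
    · rintro ⟨γ, p⟩ hq
      simp only [mem_coe, mem_sigma, mem_filter] at hq
      obtain ⟨⟨⟨h1, h2⟩, h3, h4, h5⟩, hp, h6⟩ := hq
      have hpA : p ∈ A := mem_of_mem_erase (hC.1 hp)
      simp only [mem_coe, mem_filter, mem_product]
      refine ⟨⟨⟨h1, hpA⟩, h5, fun h => hzC (sameCycle_of_eqOn h2 (fun _ _ => rfl) hp h.symm).1,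
        fun u hu => ?_, h6⟩, ?_⟩
      · by_cases huC : u ∈ C
        · exact Or.inr (h4 u huC p hp)
        · exact Or.inl (h3 u (mem_sdiff.2 ⟨hu, huC⟩) z (mem_sdiff.2 ⟨hz, hzC⟩))
      · ext u
        rw [mem_filter]
        exact ⟨fun h => (sameCycle_of_eqOn h2 (fun _ _ => rfl) hp h.2.symm).1,
          fun h => ⟨mem_of_mem_erase (hC.1 h), h4 u h p hp⟩⟩
  · rintro ⟨γ, p⟩ hq
    rw [mem_coe, mem_filter, mem_product] at hq
    rw [mem_coe, mem_filter, mem_powerset]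
    dsimp only at hq ⊢
    refine ⟨fun u hu => ?_, p, mem_filter.2 ⟨hq.1.2, Perm.SameCycle.refl _ _⟩⟩
    rw [mem_filter] at hu
    exact mem_erase.2 ⟨fun h => hq.2.2.1 (h ▸ hu.2), hu.1⟩

/-- With one cycle on `B \ C`, an even number of cycles on `B` means an odd number on `C`. -/
theorem sign_mul_eq_iff {B C : Finset α} (hC : C ⊆ B) (hne : (B \ C).Nonempty) {ρ γ : Perm α}
    (hρ : ρ ∈ permsOn (B \ C)) (hone : OneCycleOn ρ (B \ C)) :
    Perm.sign (ρ * γ) = (-1) ^ B.card ↔ Perm.sign γ = (-1) ^ (C.card + 1) := by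
  rw [Perm.sign_mul, sign_of_oneCycleOn hne hρ hone, ← card_sdiff_add_card_eq_card hC]
  have h : ((-1 : ℤˣ) ^ ((B \ C).card + C.card)) =
      (-1) ^ ((B \ C).card + 1) * (-1) ^ (C.card + 1) := by
    rw [← pow_add, show (B \ C).card + 1 + (C.card + 1) = (B \ C).card + C.card + 2 by ring,
      pow_add _ _ 2]
    simp
  rw [h]
  exact mul_right_inj _

open Classical in
-- With the cycle `ρ` through `z` absorbed into `E`, `n` times the number of passages of the other
-- cycle is its travelled distance. By `ih` that cycle may be traded for an odd number of cycles on
-- `C`, so for an even number on `A` in all.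
theorem card_mul_marked (E : Perm α) {A : Finset α} {v z : α} (hz : z ∈ A)
    (ih : ∀ C ⊆ A.erase z, C.Nonempty → ∀ E : Perm α,
      ∑ γ ∈ permsOn C with OneCycleOn γ C ∧ (E * γ).IsCycleOn Set.univ, travel (E * γ) γ C =
        Fintype.card α * #{γ ∈ permsOn C | (E * γ).IsCycleOn Set.univ ∧
          Perm.sign γ = (-1) ^ (C.card + 1)}) :
    Fintype.card α * #{q ∈ permsOn A ×ˢ A | (E * q.1).IsCycleOn Set.univ ∧
        ¬ q.1.SameCycle z q.2 ∧ (∀ u ∈ A, q.1.SameCycle u z ∨ q.1.SameCycle u q.2) ∧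
        cycDist (E * q.1) v (q.1 q.2) ≤ cycDist (E * q.1) v q.2} =
      Fintype.card α * #{γ ∈ permsOn A | (E * γ).IsCycleOn Set.univ ∧
        Perm.sign γ = (-1) ^ A.card} := by
  have hm := card_marked_eq_sum A hz (fun γ => (E * γ).IsCycleOn Set.univ)
    (fun γ p => cycDist (E * γ) v (γ p) ≤ cycDist (E * γ) v p)
  refine (congrArg (Fintype.card α * ·) (Eq.trans (by congr!) hm)).trans ?_
  rw [card_permsOn_eq_sum A hz, mul_sum, mul_sum]
  · refine sum_congr rfl fun C hC => ?_
    rw [mem_filter, mem_powerset] at hC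
    have hCA : C ⊆ A := hC.1.trans (erase_subset _ _)
    have hzC : z ∈ A \ C := mem_sdiff.2 ⟨hz, fun h => by simpa using hC.1 h⟩
    rw [sum_permsOn_invariant hCA, sum_permsOn_invariant hCA, mul_sum, mul_sum]
    refine sum_congr rfl fun ρ hρ => ?_
    by_cases hone : OneCycleOn ρ (A \ C)
    · have h := ih C hC.1 hC.2 (E * ρ)
      rw [sum_filter] at h
      rw [mul_sum, mul_sum]
      refine Eq.trans (sum_congr rfl fun γ hγ => ?_) (h.trans ?_)
      · rw [oneCycleOn_mul_left_iff hρ hγ, oneCycleOn_mul_right_iff hρ hγ, ← mul_assoc]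
        by_cases hc : OneCycleOn γ C ∧ (E * ρ * γ).IsCycleOn Set.univ
        · rw [if_pos ⟨hone, hc⟩, if_pos hc, travel_eq_card_mul hc.2
            (fun x => apply_mem_of_mem_permsOn hγ) v]
          congr 2
          refine filter_congr fun p hp => ?_
          rw [mul_apply_eq_right hρ hγ hp]
        · rw [if_neg (fun h => hc h.2), if_neg hc, mul_zero]
      · rw [← mul_sum, card_filter]
        congr 1
        refine sum_congr rfl fun γ hγ => ?_
        rw [oneCycleOn_mul_left_iff hρ hγ, ← mul_assoc]
        simp only [hone, true_and, sign_mul_eq_iff hCA ⟨z, hzC⟩ hρ hone]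
    · congr 1
      refine sum_congr rfl fun γ hγ => ?_
      rw [oneCycleOn_mul_left_iff hρ hγ, if_neg (fun h => hone h.1), if_neg (fun h => hone h.1)]
  · intro γ hγ hP hone
    have h := sign_of_oneCycleOn ⟨z, hz⟩ hγ hone
    rw [hP.2, pow_succ] at h
    rcases neg_one_pow_eq_or ℤˣ A.card with h' | h' <;> rw [h'] at h <;> simp at h

open Classical in
/-- For a fixed permutation `E`, the one-cycle permutations of `B` whose product with `E` is a full
cycle, weighted by their winding numbers, are as many as the permutations of `B` with an odd number
of cycles whose product with `E` is a full cycle. -/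
theorem sum_travel_oneCycleOn (E : Perm α) {B : Finset α} (hB : B.Nonempty) :
    ∑ γ ∈ permsOn B with OneCycleOn γ B ∧ (E * γ).IsCycleOn Set.univ, travel (E * γ) γ B =
      Fintype.card α * #{γ ∈ permsOn B | (E * γ).IsCycleOn Set.univ ∧
        Perm.sign γ = (-1) ^ (B.card + 1)} := by
  induction hc : B.card using Nat.strong_induction_on generalizing B E with
  | _ c ih =>
  obtain ⟨v, hv⟩ := hB
  by_cases hB' : (B.erase v).Nonempty
  swap
  · rw [not_nonempty_iff_eq_empty] at hB'
    obtain rfl : B = {v} := by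
      rw [← insert_erase hv, hB']
      rfl
    have hp : permsOn ({v} : Finset α) = {1} := by
      ext γ
      rw [mem_singleton]
      refine ⟨fun h => ?_, fun h => by simp [h, mem_permsOn]⟩
      ext x
      by_cases hx : x = v
      · subst hx
        simpa using (apply_mem_of_mem_permsOn h).2 (mem_singleton_self x)
      · exact mem_permsOn.1 h x (by simpa using hx)
    have hone : OneCycleOn (1 : Perm α) {v} := by
      intro x hx y hy
      rw [mem_singleton] at hx hy
      rw [hx, hy]
    rw [sum_filter, card_filter, hp, sum_singleton, sum_singleton]
    subst hc
    by_cases h : (E * 1).IsCycleOn Set.univ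
    · simp [hone, travel, cycDist_self (show E.IsCycleOn Set.univ by simpa using h)]
    · rw [if_neg (fun h' => h h'.2), if_neg (fun h' => h h'.1), mul_zero]
  have hcard : (B.erase v).card + 1 = B.card := card_erase_add_one hv
  -- After deletion of `v`, the first sum will account for the permutations moving `v`, the lost
  -- turns for those fixing it.
  have hstep : ∑ γ ∈ permsOn B with OneCycleOn γ B ∧ (E * γ).IsCycleOn Set.univ,
      travel (E * γ) γ B =
      ∑ γ ∈ permsOn B with OneCycleOn γ B ∧ (E * γ).IsCycleOn Set.univ,
        travel (E * γ) (swap v (γ v) * γ) (B.erase v) +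
      Fintype.card α * #{γ ∈ permsOn B | OneCycleOn γ B ∧ (E * γ).IsCycleOn Set.univ ∧
        Fintype.card α < cycDist (E * γ) (γ⁻¹ v) v + cycDist (E * γ) v (γ v)} := by
    rw [card_filter, mul_sum, sum_filter, sum_filter, ← sum_add_distrib]
    refine sum_congr rfl fun γ hγ => ?_
    by_cases hh : OneCycleOn γ B ∧ (E * γ).IsCycleOn Set.univ
    · obtain ⟨w, hw⟩ := hB'
      rw [if_pos hh, if_pos hh, travel_delete hh.2 hγ hv fun h =>
        ne_of_mem_erase hw ((hh.1 w (mem_of_mem_erase hw) v hv).eq_of_right h)]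
      simp only [hh.1, hh.2, true_and]
    · rw [if_neg hh, if_neg hh, if_neg (fun h => hh ⟨h.1, h.2.1⟩), mul_zero,
        add_zero]
  have hins : ∑ γ ∈ permsOn B with OneCycleOn γ B ∧ (E * γ).IsCycleOn Set.univ,
      travel (E * γ) (swap v (γ v) * γ) (B.erase v) =
      Fintype.card α * ∑ γ ∈ permsOn B with γ v ≠ v,
        if (E * γ).IsCycleOn Set.univ ∧ Perm.sign γ = (-1) ^ (B.card + 1) then 1 else 0 := by
    have h1 : ∑ γ ∈ permsOn B with OneCycleOn γ B ∧ (E * γ).IsCycleOn Set.univ,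
        travel (E * γ) (swap v (γ v) * γ) (B.erase v) =
        ∑ γ ∈ permsOn B with γ v ≠ v, if OneCycleOn γ B ∧ (E * γ).IsCycleOn Set.univ then
          travel (E * γ) (swap v (γ v) * γ) (B.erase v) else 0 := by
      rw [← sum_filter, filter_filter]
      refine sum_congr (filter_congr fun γ hγ => ⟨fun h => ⟨fun h' => ?_, h⟩, fun h => h.2⟩)
        fun _ _ => rfl
      obtain ⟨w, hw⟩ := hB'
      exact ne_of_mem_erase hw ((h.1 w (mem_of_mem_erase hw) v hv).eq_of_right h')
    rw [h1, sum_permsOn_apply_ne hv, sum_permsOn_apply_ne hv, mul_sum]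
    refine sum_congr rfl fun b hb => ?_
    -- The transposition that reinserts `v` is absorbed into the fixed factor.
    have h2 := ih (B.erase v).card (by omega) (E * swap v b) hB' rfl
    rw [card_filter, sum_filter] at h2
    refine Eq.trans (sum_congr rfl fun γ hγ => ?_) (h2.trans ?_)
    · have hγv := (mem_permsOn_erase.1 hγ).2
      rw [oneCycleOn_swap_mul_iff hv hb hγ, ← mul_assoc E, Perm.mul_apply (swap v b), hγv,
        swap_apply_left, ← mul_assoc, swap_mul_self, one_mul]
    · congr 1
      refine sum_congr rfl fun γ hγ => ?_
      rw [← mul_assoc, Perm.sign_mul, Perm.sign_swap (ne_of_mem_erase hb).symm, ← hcard,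
        pow_succ _ ((B.erase v).card + 1)]
      simp
  have hslice : Fintype.card α * #{γ ∈ permsOn B | OneCycleOn γ B ∧
        (E * γ).IsCycleOn Set.univ ∧
        Fintype.card α < cycDist (E * γ) (γ⁻¹ v) v + cycDist (E * γ) v (γ v)} =
      Fintype.card α * #{γ ∈ permsOn (B.erase v) | (E * γ).IsCycleOn Set.univ ∧
        Perm.sign γ = (-1) ^ (B.card + 1)} := by
    obtain ⟨z, hz, hlast⟩ := exists_last_before E hv
    -- If `z = v`, then `γ⁻¹ v` is the last point of `B` before `v`, so `γ v` cannot come after it;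
    -- nor can a `γ` fixing `v` give a full cycle. Both counts vanish.
    by_cases hzv : z = v
    · subst hzv
      congr 1
      obtain ⟨w, hw⟩ := hB'
      rw [filter_eq_empty_iff.2, filter_eq_empty_iff.2]
      · intro γ hγ hh
        obtain ⟨h1, h2⟩ := mem_permsOn_erase.1 hγ
        exact ne_of_mem_erase hw ((hlast γ h1 hh.1).2 (Perm.inv_eq_iff_eq.2 h2.symm) w
          (mem_of_mem_erase hw))
      · intro γ hγ hh
        have hne : γ z ≠ z := fun h =>
          ne_of_mem_erase hw ((hh.1 w (mem_of_mem_erase hw) z hv).eq_of_right h)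
        have h1 := (hlast γ hγ hh.2.1).1 (γ z) ((apply_mem_of_mem_permsOn hγ).2 hv) hne
        have h2 : γ⁻¹ z ≠ z := fun h => hne (Perm.inv_eq_iff_eq.1 h).symm
        have h3 := cycDist_add_swap hh.2.1 h2
        omega
    · have hzB' : z ∈ B.erase v := mem_erase.2 ⟨hzv, hz⟩
      rw [card_slice E hv hz hzv hlast, card_mul_marked E hzB']
      · rw [← hcard, pow_add _ _ 1, pow_add _ _ 1]
        simp
      · intro C hC hCne E'
        have h1 := card_le_card hC
        have h2 := card_erase_add_one hzB'
        exact ih C.card (by omega) E' hCne rfl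
  rw [← hc, hstep, hins, hslice, card_filter, card_filter, ← mul_add, sum_permsOn_eq_add hv,
    sum_permsOn_apply_ne hv, add_comm]

end Main

/-! ### Cycles as blocks, and merging them -/

section CycleSets

variable {α : Type*} [Fintype α] [DecidableEq α]

open Classical in
/-- The set of cycles of a permutation, each given as a set of points. -/
noncomputable def cycleSets (σ : Perm α) : Finset (Finset α) :=
  univ.image fun x => univ.filter fun y => σ.SameCycle x y

theorem mem_cycleSets {σ : Perm α} {C : Finset α} :
    C ∈ cycleSets σ ↔ C.Nonempty ∧ (∀ x, σ x ∈ C ↔ x ∈ C) ∧ OneCycleOn σ C := by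
  classical
  unfold cycleSets
  rw [mem_image]
  constructor
  · rintro ⟨x, -, rfl⟩
    refine ⟨⟨x, by simp [Perm.SameCycle.refl]⟩, fun y => by simp [Perm.sameCycle_apply_right], ?_⟩
    intro y hy z hz
    rw [mem_filter] at hy hz
    exact hy.2.symm.trans hz.2
  · rintro ⟨⟨x, hx⟩, h1, h2⟩
    refine ⟨x, mem_univ _, ?_⟩
    ext y
    rw [mem_filter]
    exact ⟨fun h => (sameCycle_of_eqOn h1 (fun _ _ => rfl) hx h.2).1,
      fun h => ⟨mem_univ _, h2 x hx y h⟩⟩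

theorem exists_mem_cycleSets (σ : Perm α) (x : α) : ∃ C ∈ cycleSets σ, x ∈ C := by
  classical
  exact ⟨_, mem_image_of_mem _ (mem_univ x), by simp [Perm.SameCycle.refl]⟩

theorem subset_of_mem_cycleSets {σ : Perm α} {C D : Finset α} (hD : D ∈ cycleSets σ)
    (hC : ∀ x, σ x ∈ C ↔ x ∈ C) {x : α} (hxD : x ∈ D) (hxC : x ∈ C) : D ⊆ C := by
  rw [mem_cycleSets] at hD
  exact fun y hy => (sameCycle_of_eqOn hC (fun _ _ => rfl) hxC (hD.2.2 x hxD y hy)).1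

theorem eq_of_mem_cycleSets {σ : Perm α} {C D : Finset α} (hC : C ∈ cycleSets σ)
    (hD : D ∈ cycleSets σ) {x : α} (hxC : x ∈ C) (hxD : x ∈ D) : C = D :=
  (subset_of_mem_cycleSets hC (mem_cycleSets.1 hD).2.1 hxC hxD).antisymm
    (subset_of_mem_cycleSets hD (mem_cycleSets.1 hC).2.1 hxD hxC)

theorem cycleSets_pairwiseDisjoint (σ : Perm α) :
    (cycleSets σ : Set (Finset α)).PairwiseDisjoint id := by
  intro C hC D hD hne
  rw [Function.onFun, disjoint_left]
  exact fun x hxC hxD => hne (eq_of_mem_cycleSets hC hD hxC hxD)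

theorem biUnion_cycleSets (σ : Perm α) : (cycleSets σ).biUnion id = univ := by
  ext x
  simpa using exists_mem_cycleSets σ x

theorem sameCycle_iff_exists_mem_cycleSets {σ : Perm α} {x y : α} :
    σ.SameCycle x y ↔ ∃ C ∈ cycleSets σ, x ∈ C ∧ y ∈ C := by
  constructor
  · intro h
    obtain ⟨C, hC, hx⟩ := exists_mem_cycleSets σ x
    exact ⟨C, hC, hx, (sameCycle_of_eqOn (mem_cycleSets.1 hC).2.1 (fun _ _ => rfl) hx h).1⟩
  · rintro ⟨C, hC, hx, hy⟩
    exact (mem_cycleSets.1 hC).2.2 x hx y hy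

theorem cycleSets_eq_union (σ : Perm α) :
    cycleSets σ = σ.cycleFactorsFinset.image Perm.support ∪
      (univ.filter fun x => σ x = x).image fun x => {x} := by
  ext C
  rw [mem_union, mem_image, mem_image]
  constructor
  · intro hC
    obtain ⟨x, hx⟩ := (mem_cycleSets.1 hC).1
    have hCx : ∀ y, y ∈ C ↔ σ.SameCycle x y := fun y =>
      ⟨fun hy => (mem_cycleSets.1 hC).2.2 x hx y hy, fun h =>
        (sameCycle_of_eqOn (mem_cycleSets.1 hC).2.1 (fun _ _ => rfl) hx h).1⟩
    by_cases hf : σ x = x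
    · right
      refine ⟨x, by simp [hf], ?_⟩
      ext y
      rw [mem_singleton, hCx]
      exact ⟨fun h => h ▸ Perm.SameCycle.refl _ _, fun h => (h.eq_of_left hf).symm⟩
    · left
      refine ⟨σ.cycleOf x, Perm.cycleOf_mem_cycleFactorsFinset_iff.2 (Perm.mem_support.2 hf), ?_⟩
      ext y
      rw [hCx, Perm.mem_support_cycleOf_iff' hf]
  · rintro (⟨p, hp, rfl⟩ | ⟨x, hx, rfl⟩)
    · have h := Perm.isCycleOn_support_of_mem_cycleFactorsFinset hp
      rw [mem_cycleSets]
      exact ⟨(Perm.mem_cycleFactorsFinset_iff.1 hp).1.nonempty_support,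
        fun x => by simpa using h.apply_mem_iff (x := x),
        fun x hx y hy => h.2 (mem_coe.2 hx) (mem_coe.2 hy)⟩
    · rw [mem_filter] at hx
      rw [mem_cycleSets]
      refine ⟨singleton_nonempty x, fun y => ?_, ?_⟩
      · rw [mem_singleton, mem_singleton]
        exact ⟨fun h => σ.injective (h.trans hx.2.symm), fun h => h ▸ hx.2⟩
      · intro y hy z hz
        rw [mem_singleton] at hy hz
        rw [hy, hz]

theorem parts_partition_eq_map_card (σ : Perm α) :
    σ.partition.parts = (cycleSets σ).val.map Finset.card := by
  have hdisj : Disjoint (σ.cycleFactorsFinset.image Perm.support)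
      ((univ.filter fun x => σ x = x).image fun x => {x}) := by
    rw [disjoint_left]
    intro C h1 h2
    obtain ⟨p, hp, rfl⟩ := mem_image.1 h1
    obtain ⟨x, -, hx⟩ := mem_image.1 h2
    have := (Perm.mem_cycleFactorsFinset_iff.1 hp).1.two_le_card_support
    rw [← hx, card_singleton] at this
    omega
  have hinj : Set.InjOn Perm.support (σ.cycleFactorsFinset : Set (Perm α)) := by
    intro p hp q hq hpq
    have h1 := (Perm.mem_cycleFactorsFinset_iff.1 hp).2
    have h2 := (Perm.mem_cycleFactorsFinset_iff.1 hq).2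
    ext x
    by_cases hx : x ∈ p.support
    · rw [h1 x hx, h2 x (hpq ▸ hx)]
    · rw [Perm.notMem_support.1 hx, Perm.notMem_support.1 (hpq ▸ hx)]
  have hfix : #(univ.filter fun x => σ x = x) = Fintype.card α - #σ.support := by
    rw [← card_compl]
    congr 1
    ext x
    simp
  rw [Perm.parts_partition, cycleSets_eq_union, ← disjUnion_eq_union _ _ hdisj, disjUnion_val,
    Multiset.map_add, image_val_of_injOn hinj, image_val_of_injOn (singleton_injective.injOn),
    Multiset.map_map, Multiset.map_map, Perm.cycleType_def]
  congr 1
  rw [← hfix]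
  exact (Multiset.map_const' _ _).symm

theorem sign_eq_neg_one_pow (σ : Perm α) :
    Perm.sign σ = (-1) ^ (Fintype.card α + #(cycleSets σ)) := by
  have h : #(cycleSets σ) = Multiset.card σ.partition.parts := by
    rw [parts_partition_eq_map_card, Multiset.card_map]
    rfl
  have h2 : #σ.support ≤ Fintype.card α := card_le_univ _
  rw [h, Perm.parts_partition, Multiset.card_add, Multiset.card_replicate, Perm.sign_of_cycleType,
    Perm.sum_cycleType]
  rw [show Fintype.card α + (Multiset.card σ.cycleType + (Fintype.card α - #σ.support)) =
    #σ.support + Multiset.card σ.cycleType + 2 * (Fintype.card α - #σ.support) by omega,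
    pow_add _ _ (2 * _), pow_mul]
  simp

/-- The side conditions discard the fixed points of `ρ` in `C` and those of `γ` outside `C`. -/
theorem mul_mem_cycleSets_iff {C D : Finset α} {ρ γ : Perm α} (hρ : ρ ∈ permsOn (univ \ C))
    (hγ : γ ∈ permsOn C) :
    D ∈ cycleSets (ρ * γ) ↔ (D ∈ cycleSets ρ ∧ Disjoint D C) ∨ (D ∈ cycleSets γ ∧ D ⊆ C) := by
  have hstab := mul_apply_mem_iff hρ hγ
  have hr : ∀ x ∈ C, (ρ * γ) x = γ x := fun x hx => mul_apply_eq_right hρ hγ hx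
  have hl : ∀ x ∉ C, (ρ * γ) x = ρ x := fun x hx => mul_apply_eq_left hγ hx
  have hρC : ∀ x ∈ C, ρ x = x := fun x hx => mem_permsOn.1 hρ x (by simp [hx])
  have hγC : ∀ x ∉ C, γ x = x := fun x hx => mem_permsOn.1 hγ x hx
  have hnot : ∀ {D : Finset α}, Disjoint D C → ∀ x ∈ D, x ∉ C :=
    fun h x hx => disjoint_left.1 h hx
  constructor
  · intro hD
    have hD' := mem_cycleSets.1 hD
    by_cases hDC : Disjoint D C
    · left
      refine ⟨mem_cycleSets.2 ⟨hD'.1, fun x => ?_, oneCycleOn_congr hD'.2.1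
        (fun x hx => hl x (hnot hDC x hx)) hD'.2.2⟩, hDC⟩
      by_cases hx : x ∈ C
      · rw [hρC x hx]
      · rw [← hl x hx, hD'.2.1]
    · right
      obtain ⟨x, hxD, hxC⟩ := not_disjoint_iff.1 hDC
      have hsub := subset_of_mem_cycleSets hD hstab hxD hxC
      refine ⟨mem_cycleSets.2 ⟨hD'.1, fun x => ?_, oneCycleOn_congr hD'.2.1
        (fun x hx => hr x (hsub hx)) hD'.2.2⟩, hsub⟩
      by_cases hx : x ∈ C
      · rw [← hr x hx, hD'.2.1]
      · rw [hγC x hx]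
  · rintro (⟨hD, hDC⟩ | ⟨hD, hDC⟩) <;> rw [mem_cycleSets] at hD ⊢
    · refine ⟨hD.1, fun x => ?_, oneCycleOn_congr hD.2.1
        (fun x hx => (hl x (hnot hDC x hx)).symm) hD.2.2⟩
      by_cases hx : x ∈ C
      · exact ⟨fun h => absurd ((hstab x).2 hx) (hnot hDC _ h), fun h => absurd hx (hnot hDC _ h)⟩
      · rw [hl x hx, hD.2.1]
    · refine ⟨hD.1, fun x => ?_, oneCycleOn_congr hD.2.1
        (fun x hx => (hr x (hDC hx)).symm) hD.2.2⟩
      by_cases hx : x ∈ C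
      · rw [hr x hx, hD.2.1]
      · exact ⟨fun h => absurd ((hstab x).1 (hDC h)) hx, fun h => absurd (hDC h) hx⟩

theorem filter_disjoint_cycleSets_mul {C : Finset α} {ρ γ : Perm α} (hρ : ρ ∈ permsOn (univ \ C))
    (hγ : γ ∈ permsOn C) :
    {D ∈ cycleSets (ρ * γ) | Disjoint D C} = {D ∈ cycleSets ρ | Disjoint D C} := by
  ext D
  rw [mem_filter, mem_filter, mul_mem_cycleSets_iff hρ hγ]
  constructor
  · rintro ⟨h | h, h'⟩
    · exact h
    · exact absurd ((mem_cycleSets.1 h.1).1) (by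
        rw [not_nonempty_iff_eq_empty, ← disjoint_self_iff_empty]
        exact h'.mono_right h.2)
  · exact fun h => ⟨Or.inl h, h.2⟩

theorem filter_subset_cycleSets_mul {C : Finset α} {ρ γ : Perm α} (hρ : ρ ∈ permsOn (univ \ C))
    (hγ : γ ∈ permsOn C) :
    {D ∈ cycleSets (ρ * γ) | D ⊆ C} = {D ∈ cycleSets γ | D ⊆ C} := by
  ext D
  rw [mem_filter, mem_filter, mul_mem_cycleSets_iff hρ hγ]
  constructor
  · rintro ⟨h | h, h'⟩
    · exact absurd ((mem_cycleSets.1 h.1).1) (by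
        rw [not_nonempty_iff_eq_empty, ← disjoint_self_iff_empty]
        exact h.2.mono_right h')
    · exact h
  · exact fun h => ⟨Or.inr h, h.2⟩

theorem cycleSets_eq_insert {σ : Perm α} {C : Finset α} (hC : C ∈ cycleSets σ) :
    cycleSets σ = insert C {D ∈ cycleSets σ | Disjoint D C} := by
  ext D
  rw [mem_insert, mem_filter]
  constructor
  · intro hD
    by_cases h : D = C
    · exact Or.inl h
    · exact Or.inr ⟨hD, cycleSets_pairwiseDisjoint σ hD hC h⟩
  · rintro (rfl | h)
    · exact hC
    · exact h.1

/-- The points outside `C` enter the sign formula twice, as points and as singleton cycles, and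
cancel. -/
theorem odd_card_filter_iff {C : Finset α} {γ : Perm α} (hγ : γ ∈ permsOn C) :
    Odd #{D ∈ cycleSets γ | D ⊆ C} ↔ Perm.sign γ = (-1) ^ (C.card + 1) := by
  have hone : (1 : Perm α) ∈ permsOn (univ \ C) := by simp [mem_permsOn]
  have hsplit : cycleSets γ = (univ \ C).image (fun x => {x}) ∪ {D ∈ cycleSets γ | D ⊆ C} := by
    have h := fun D => mul_mem_cycleSets_iff (D := D) hone hγ
    rw [one_mul] at h
    ext D
    rw [h, mem_union, mem_filter, mem_image]
    refine or_congr ?_ Iff.rfl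
    rw [cycleSets_eq_union]
    simp only [mem_union, mem_image, mem_filter, mem_univ, true_and, Perm.cycleFactorsFinset_one,
      notMem_empty, false_and, exists_false, false_or, Perm.one_apply, mem_sdiff]
    constructor
    · rintro ⟨⟨x, rfl⟩, hx⟩
      exact ⟨x, by simpa using hx, rfl⟩
    · rintro ⟨x, hx, rfl⟩
      exact ⟨⟨x, rfl⟩, by simpa using hx⟩
  have hdisj : Disjoint ((univ \ C).image (fun x => ({x} : Finset α)))
      {D ∈ cycleSets γ | D ⊆ C} := by
    rw [disjoint_left]
    intro D h1 h2
    obtain ⟨x, hx, rfl⟩ := mem_image.1 h1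
    exact (mem_sdiff.1 hx).2 ((mem_filter.1 h2).2 (mem_singleton_self x))
  have hcard : #(cycleSets γ) = #(univ \ C) + #{D ∈ cycleSets γ | D ⊆ C} := by
    conv_lhs => rw [hsplit, card_union_of_disjoint hdisj,
      card_image_of_injective _ singleton_injective]
  have hn : #(univ \ C) + #C = Fintype.card α := card_sdiff_add_card_eq_card (subset_univ C)
  rw [sign_eq_neg_one_pow, hcard, ← hn]
  generalize #{D ∈ cycleSets γ | D ⊆ C} = r
  rw [show #(univ \ C) + #C + (#(univ \ C) + r) = 2 * #(univ \ C) + (#C + r) by ring, pow_add,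
    pow_mul, pow_add, pow_add]
  simp only [even_two, Even.neg_pow, one_pow, one_mul, pow_one, mul_right_inj]
  rcases Nat.even_or_odd r with h | h
  · rw [h.neg_one_pow]
    exact ⟨fun h' => absurd h' (by simpa using h), fun h' => by simp at h'⟩
  · rw [h.neg_one_pow]
    exact ⟨fun _ => rfl, fun _ => h⟩

theorem biUnion_filter_subset {σ : Perm α} {C : Finset α} (hC : ∀ x, σ x ∈ C ↔ x ∈ C) :
    {D ∈ cycleSets σ | D ⊆ C}.biUnion id = C := by
  ext x
  simp only [mem_biUnion, mem_filter, id]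
  constructor
  · rintro ⟨D, ⟨-, hD⟩, hx⟩
    exact hD hx
  · intro hx
    obtain ⟨D, hD, hxD⟩ := exists_mem_cycleSets σ x
    exact ⟨D, ⟨hD, subset_of_mem_cycleSets hD hC hxD hx⟩, hxD⟩

theorem apply_mem_biUnion_iff {σ : Perm α} {S : Finset (Finset α)} (hS : S ⊆ cycleSets σ) (x : α) :
    σ x ∈ S.biUnion id ↔ x ∈ S.biUnion id := by
  simp only [mem_biUnion, id]
  exact exists_congr fun D => and_congr_right fun hD => (mem_cycleSets.1 (hS hD)).2.1 x

theorem filter_subset_biUnion {σ : Perm α} {S : Finset (Finset α)} (hS : S ⊆ cycleSets σ) :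
    {D ∈ cycleSets σ | D ⊆ S.biUnion id} = S := by
  ext D
  rw [mem_filter]
  constructor
  · rintro ⟨hD, hsub⟩
    obtain ⟨x, hx⟩ := (mem_cycleSets.1 hD).1
    obtain ⟨D', hD', hx'⟩ := mem_biUnion.1 (hsub hx)
    rwa [eq_of_mem_cycleSets hD (hS hD') hx hx']
  · exact fun h => ⟨hS h, subset_biUnion_of_mem id h⟩

theorem filter_disjoint_eq_sdiff {σ : Perm α} {C : Finset α} (hC : ∀ x, σ x ∈ C ↔ x ∈ C) :
    {D ∈ cycleSets σ | Disjoint D C} = cycleSets σ \ {D ∈ cycleSets σ | D ⊆ C} := by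
  ext D
  rw [mem_filter, mem_sdiff, mem_filter]
  refine and_congr_right fun hD => ?_
  obtain ⟨x, hx⟩ := (mem_cycleSets.1 hD).1
  constructor
  · exact fun h h' => disjoint_left.1 h hx (h'.2 hx)
  · intro h
    rw [disjoint_left]
    exact fun y hy hyC => h ⟨hD, subset_of_mem_cycleSets hD hC hy hyC⟩

open Classical in
-- A set of cycles is recovered from its union. Unlike the set of cycles, the union `C` can be fixed
-- before the permutation.
theorem card_odd_subsets_eq (σ : Perm α) (Q : Finset (Finset α) → Prop) :
    #{S ∈ (cycleSets σ).powerset | Odd #S ∧ Q (insert (S.biUnion id) (cycleSets σ \ S))} =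
      #{C : Finset α | C.Nonempty ∧ (∀ x, σ x ∈ C ↔ x ∈ C) ∧ Odd #{D ∈ cycleSets σ | D ⊆ C} ∧
        Q (insert C {D ∈ cycleSets σ | Disjoint D C})} := by
  refine card_nbij' (fun S => S.biUnion id) (fun C => {D ∈ cycleSets σ | D ⊆ C}) ?_ ?_ ?_ ?_
  · intro S hS
    rw [mem_coe, mem_filter, mem_powerset] at hS
    obtain ⟨hS, hodd, hQ⟩ := hS
    have hstab := apply_mem_biUnion_iff hS
    rw [mem_coe, mem_filter]
    refine ⟨mem_univ _, ?_, hstab, ?_, ?_⟩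
    · obtain ⟨D, hD⟩ := card_pos.1 hodd.pos
      obtain ⟨x, hx⟩ := (mem_cycleSets.1 (hS hD)).1
      exact ⟨x, mem_biUnion.2 ⟨D, hD, hx⟩⟩
    · rwa [filter_subset_biUnion hS]
    · rwa [filter_disjoint_eq_sdiff hstab, filter_subset_biUnion hS]
  · intro C hC
    rw [mem_coe, mem_filter] at hC
    obtain ⟨-, -, hstab, hodd, hQ⟩ := hC
    rw [mem_coe, mem_filter, mem_powerset]
    refine ⟨filter_subset _ _, hodd, ?_⟩
    rwa [biUnion_filter_subset hstab, ← filter_disjoint_eq_sdiff hstab]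
  · intro S hS
    rw [mem_coe, mem_filter, mem_powerset] at hS
    exact filter_subset_biUnion hS.1
  · intro C hC
    rw [mem_coe, mem_filter] at hC
    exact biUnion_filter_subset hC.2.2.1

theorem permsOn_univ : permsOn (univ : Finset α) = univ := by
  ext γ
  simp [mem_permsOn]

theorem travel_univ_eq_sum (s σ : Perm α) :
    travel s σ univ = ∑ C ∈ cycleSets σ, travel s σ C := by
  unfold travel
  rw [← biUnion_cycleSets σ, sum_biUnion (cycleSets_pairwiseDisjoint σ)]
  rfl

open Classical in
/-- For a fixed permutation `E`, marking an odd number of cycles of `π` and merging them amounts to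
weighting `π` with its winding number around the full cycle `E * π`. -/
theorem sum_travel_eq (E : Perm α) (Q : Finset (Finset α) → Prop) :
    ∑ π : Perm α with (E * π).IsCycleOn Set.univ ∧ Q (cycleSets π), travel (E * π) π univ =
      Fintype.card α * ∑ π : Perm α with (E * π).IsCycleOn Set.univ,
        #{S ∈ (cycleSets π).powerset |
          Odd #S ∧ Q (insert (S.biUnion id) (cycleSets π \ S))} := by
  have hL : ∑ π : Perm α with (E * π).IsCycleOn Set.univ ∧ Q (cycleSets π),
      travel (E * π) π univ =
      ∑ C : Finset α with C.Nonempty, ∑ π ∈ permsOn univ with ∀ x, π x ∈ C ↔ x ∈ C,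
        if OneCycleOn π C ∧ (E * π).IsCycleOn Set.univ ∧ Q (cycleSets π) then
          travel (E * π) π C else 0 := by
    rw [permsOn_univ, sum_filter]
    simp_rw [sum_filter]
    have h : ∀ C : Finset α, (if C.Nonempty then ∑ π : Perm α, if ∀ x, π x ∈ C ↔ x ∈ C then
        if OneCycleOn π C ∧ (E * π).IsCycleOn Set.univ ∧ Q (cycleSets π) then
          travel (E * π) π C else 0 else 0 else 0) =
        ∑ π : Perm α, if C ∈ cycleSets π then
          if (E * π).IsCycleOn Set.univ ∧ Q (cycleSets π) then travel (E * π) π C else 0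
          else 0 := by
      intro C
      by_cases hC : C.Nonempty
      · rw [if_pos hC]
        refine sum_congr rfl fun π _ => ?_
        simp only [mem_cycleSets, hC, true_and]
        by_cases h1 : ∀ x, π x ∈ C ↔ x ∈ C <;> by_cases h2 : OneCycleOn π C <;> simp [h1, h2]
      · rw [if_neg hC]
        refine (sum_eq_zero fun π _ => ?_).symm
        rw [if_neg fun h => hC (mem_cycleSets.1 h).1]
    simp_rw [h]
    rw [sum_comm]
    refine sum_congr rfl fun π _ => ?_
    rw [← sum_filter, filter_mem_eq_inter, univ_inter]
    by_cases hc : (E * π).IsCycleOn Set.univ ∧ Q (cycleSets π)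
    · simp_rw [if_pos hc]
      exact travel_univ_eq_sum _ _
    · simp_rw [if_neg hc]
      simp
  have hR : ∑ π : Perm α with (E * π).IsCycleOn Set.univ,
        #{S ∈ (cycleSets π).powerset |
          Odd #S ∧ Q (insert (S.biUnion id) (cycleSets π \ S))} =
      ∑ C : Finset α with C.Nonempty, ∑ π ∈ permsOn univ with ∀ x, π x ∈ C ↔ x ∈ C,
        if (E * π).IsCycleOn Set.univ ∧ Odd #{D ∈ cycleSets π | D ⊆ C} ∧
          Q (insert C {D ∈ cycleSets π | Disjoint D C}) then 1 else 0 := by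
    rw [permsOn_univ]
    simp_rw [card_odd_subsets_eq, sum_filter]
    have h : ∀ π : Perm α, (if (E * π).IsCycleOn Set.univ then
        #{C : Finset α | C.Nonempty ∧ (∀ x, π x ∈ C ↔ x ∈ C) ∧
          Odd #{D ∈ cycleSets π | D ⊆ C} ∧
          Q (insert C {D ∈ cycleSets π | Disjoint D C})} else 0) =
        ∑ C : Finset α, if C.Nonempty then if ∀ x, π x ∈ C ↔ x ∈ C then
          if (E * π).IsCycleOn Set.univ ∧ Odd #{D ∈ cycleSets π | D ⊆ C} ∧
          Q (insert C {D ∈ cycleSets π | Disjoint D C}) then 1 else 0 else 0 else 0 := by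
      intro π
      by_cases hf : (E * π).IsCycleOn Set.univ
      · rw [if_pos hf, card_filter]
        refine sum_congr rfl fun C _ => ?_
        simp only [hf, true_and, ite_and]
      · simp [hf]
    refine (sum_congr rfl fun π _ => Eq.trans (by congr!) (h π)).trans ?_
    rw [sum_comm]
    refine sum_congr rfl fun C _ => ?_
    by_cases hC : C.Nonempty <;> simp [hC]
  rw [hL, hR, mul_sum]
  refine sum_congr rfl fun C hC => ?_
  have hCne : C.Nonempty := (mem_filter.1 hC).2
  rw [sum_permsOn_invariant (subset_univ C), sum_permsOn_invariant (subset_univ C), mul_sum]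
  refine sum_congr rfl fun ρ hρ => ?_
  -- For `π = ρ * γ` with `γ` living on `C`, the factor `ρ` joins `E`, and the condition `Q` on the
  -- merged blocks depends only on `C` and `ρ`.
  have hmain := sum_travel_oneCycleOn (E * ρ) hCne
  rw [sum_filter, card_filter] at hmain
  by_cases hQ : Q (insert C {D ∈ cycleSets ρ | Disjoint D C})
  · refine Eq.trans (sum_congr rfl fun γ hγ => ?_)
      (hmain.trans (congrArg _ (sum_congr rfl fun γ hγ => ?_)))
    · rw [oneCycleOn_mul_right_iff hρ hγ, ← mul_assoc]
      by_cases hone : OneCycleOn γ C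
      · have hmem : C ∈ cycleSets (ρ * γ) := mem_cycleSets.2
          ⟨hCne, mul_apply_mem_iff hρ hγ, (oneCycleOn_mul_right_iff hρ hγ).2 hone⟩
        rw [cycleSets_eq_insert hmem, filter_disjoint_cycleSets_mul hρ hγ,
          travel_congr fun x hx => mul_apply_eq_right hρ hγ hx]
        simp [hone, hQ]
      · simp [hone]
    · simp only [filter_disjoint_cycleSets_mul hρ hγ, filter_subset_cycleSets_mul hρ hγ,
        odd_card_filter_iff hγ, hQ, and_true, mul_assoc]
  · rw [sum_eq_zero, sum_eq_zero, mul_zero]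
    · intro γ hγ
      rw [if_neg]
      rw [filter_disjoint_cycleSets_mul hρ hγ]
      exact fun h => hQ h.2.2
    · intro γ hγ
      rw [if_neg]
      rintro ⟨hone, -, h⟩
      have hmem : C ∈ cycleSets (ρ * γ) := mem_cycleSets.2
          ⟨hCne, mul_apply_mem_iff hρ hγ, hone⟩
      rw [cycleSets_eq_insert hmem, filter_disjoint_cycleSets_mul hρ hγ] at h
      exact hQ h

end CycleSets

/-! ### Exchanging the roles of diagonal and vertical -/

section Symmetry

variable {α : Type*}

theorem full_mul_comm {D π : Perm α} (h : (D * π).IsCycleOn Set.univ) :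
    (π * D).IsCycleOn Set.univ := by
  have h' := h.conj (g := D⁻¹)
  rw [Set.image_univ_of_surjective (D⁻¹).surjective] at h'
  simpa [mul_assoc] using h'

variable [Fintype α]

theorem travel_conj (s γ g : Perm α) :
    travel (g * s * g⁻¹) (g * γ * g⁻¹) univ = travel s γ univ := by
  unfold travel
  refine (Equiv.sum_comp g _).symm.trans (sum_congr rfl fun x _ => ?_)
  rw [show (g * γ * g⁻¹) (g x) = g (γ x) by simp, cycDist_conj]

/-- Conjugation by `D⁻¹` turns `D * π` into `π * D` and fixes `D`; this puts the varying factor on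
the right, as in `sum_travel_eq`. -/
theorem travel_mul_comm (D π : Perm α) :
    travel (π * D) D univ = travel (D * π) D univ := by
  have h := travel_conj (D * π) D D⁻¹
  rw [← h]
  simp

/-- The way `x → π x → D (π x)` has at least two steps and ends one step after `x`, so it takes `n +
1` steps. -/
theorem travel_add_travel {D π : Perm α} (h : (D * π).IsCycleOn Set.univ) :
    travel (D * π) π univ + travel (D * π) D univ =
      Fintype.card α * (Fintype.card α + 1) := by
  unfold travel
  rw [← Equiv.sum_comp π fun x => cycDist (D * π) x (D x), ← sum_add_distrib,
    sum_congr rfl fun x _ => ?_, sum_const, card_univ, smul_eq_mul]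
  have h1 := cycDist_add h x (π x) ((D * π) x)
  have h2 := cycDist_pos h x (π x)
  have h3 := cycDist_pos h (π x) ((D * π) x)
  rw [cycDist_apply h] at h1
  rw [Perm.mul_apply] at h1 h3
  omega

variable [DecidableEq α]

open Classical in
/-- The sum, over all factorizations of full cycles, of the two symmetric winding identities. -/
theorem card_factorizations (P Q : Finset (Finset α) → Prop) [Nonempty α] :
    (Fintype.card α + 1) *
      #{q : Perm α × Perm α | (q.1 * q.2).IsCycleOn Set.univ ∧ P (cycleSets q.1) ∧
        Q (cycleSets q.2)} =
      (∑ q : Perm α × Perm α with (q.1 * q.2).IsCycleOn Set.univ ∧ P (cycleSets q.1),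
        #{S ∈ (cycleSets q.2).powerset |
          Odd #S ∧ Q (insert (S.biUnion id) (cycleSets q.2 \ S))}) +
      ∑ q : Perm α × Perm α with (q.1 * q.2).IsCycleOn Set.univ ∧ Q (cycleSets q.2),
        #{S ∈ (cycleSets q.1).powerset |
          Odd #S ∧ P (insert (S.biUnion id) (cycleSets q.1 \ S))} := by
  refine Nat.eq_of_mul_eq_mul_left (Fintype.card_pos (α := α)) ?_
  have hA : Fintype.card α * ∑ q : Perm α × Perm α with (q.1 * q.2).IsCycleOn Set.univ ∧
      P (cycleSets q.1), #{S ∈ (cycleSets q.2).powerset |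
          Odd #S ∧ Q (insert (S.biUnion id) (cycleSets q.2 \ S))} =
      ∑ q : Perm α × Perm α with (q.1 * q.2).IsCycleOn Set.univ ∧ P (cycleSets q.1) ∧
        Q (cycleSets q.2), travel (q.1 * q.2) q.2 univ := by
    rw [sum_filter, sum_filter, Fintype.sum_prod_type, Fintype.sum_prod_type, mul_sum]
    refine sum_congr rfl fun D _ => ?_
    have h := sum_travel_eq D Q
    rw [sum_filter, sum_filter] at h
    by_cases hP : P (cycleSets D)
    · simp only [hP, and_true, true_and]
      exact h.symm
    · simp [hP]
  have hB : Fintype.card α * ∑ q : Perm α × Perm α with (q.1 * q.2).IsCycleOn Set.univ ∧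
      Q (cycleSets q.2), #{S ∈ (cycleSets q.1).powerset |
          Odd #S ∧ P (insert (S.biUnion id) (cycleSets q.1 \ S))} =
      ∑ q : Perm α × Perm α with (q.1 * q.2).IsCycleOn Set.univ ∧ P (cycleSets q.1) ∧
        Q (cycleSets q.2), travel (q.1 * q.2) q.1 univ := by
    rw [sum_filter, sum_filter, Fintype.sum_prod_type_right, Fintype.sum_prod_type_right, mul_sum]
    refine sum_congr rfl fun π _ => ?_
    have h := sum_travel_eq π P
    rw [sum_filter, sum_filter] at h
    have hc : ∀ D : Perm α, (π * D).IsCycleOn Set.univ ↔ (D * π).IsCycleOn Set.univ :=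
      fun D => ⟨full_mul_comm, full_mul_comm⟩
    have ht : ∀ D : Perm α, travel (π * D) D univ = travel (D * π) D univ :=
      fun D => travel_mul_comm D π
    simp only [hc, ht] at h
    by_cases hQ : Q (cycleSets π)
    · simp only [hQ, and_true]
      exact h.symm
    · simp [hQ]
  rw [mul_add, hA, hB, ← sum_add_distrib,
    sum_congr rfl fun q hq => travel_add_travel (mem_filter.1 hq).2.1, sum_const, smul_eq_mul]
  ring

end Symmetry

/-! ### Subsets with at most one marked element -/

section Counting

variable {β : Type*} [DecidableEq β]

/-- Subsets of size `r` of a finite set which meet the subset `M` at most once. -/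
theorem card_powersetCard_filter_inter_le_one {P M : Finset β} (hM : M ⊆ P) (r : ℕ) :
    #{S ∈ P.powersetCard (r + 1) | #(S ∩ M) ≤ 1} =
      #M * (#P - #M).choose r + (#P - #M).choose (r + 1) := by
  have hU : #(P \ M) = #P - #M := card_sdiff_of_subset hM
  have h0 : {S ∈ P.powersetCard (r + 1) | #(S ∩ M) = 0} = (P \ M).powersetCard (r + 1) := by
    ext S
    rw [mem_filter, mem_powersetCard, mem_powersetCard, card_eq_zero, ← disjoint_iff_inter_eq_empty,
      subset_sdiff]
    tauto
  have h1 : #{S ∈ P.powersetCard (r + 1) | #(S ∩ M) = 1} =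
      #(M ×ˢ (P \ M).powersetCard r) := by
    symm
    refine card_nbij (fun q => insert q.1 q.2) ?_ ?_ ?_
    · rintro ⟨a, S⟩ h
      rw [mem_coe, mem_product, mem_powersetCard, subset_sdiff] at h
      obtain ⟨ha, ⟨hS, hd⟩, hc⟩ := h
      dsimp only at *
      rw [mem_coe, mem_filter, mem_powersetCard, insert_subset_iff,
        card_insert_of_notMem (fun h => disjoint_left.1 hd h ha), hc,
        insert_inter_of_mem ha, disjoint_iff_inter_eq_empty.1 hd]
      exact ⟨⟨⟨hM ha, hS⟩, rfl⟩, rfl⟩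
    · rintro ⟨a, S⟩ h ⟨b, T⟩ h' heq
      rw [mem_coe, mem_product, mem_powersetCard, subset_sdiff] at h h'
      obtain ⟨ha, ⟨hS, hd⟩, hc⟩ := h
      obtain ⟨ha', ⟨hS', hd'⟩, hc'⟩ := h'
      dsimp only at *
      have h1 : insert a S ∩ M = {a} := by
        rw [insert_inter_of_mem ha, disjoint_iff_inter_eq_empty.1 hd]
        rfl
      have h2 : insert b T ∩ M = {b} := by
        rw [insert_inter_of_mem ha', disjoint_iff_inter_eq_empty.1 hd']
        rfl
      obtain rfl : a = b := singleton_injective (by rw [← h1, ← h2, heq])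
      rw [Prod.mk.injEq]
      refine ⟨rfl, ?_⟩
      rw [← erase_insert (fun h => disjoint_left.1 hd h ha), heq,
        erase_insert (fun h => disjoint_left.1 hd' h ha)]
    · intro S hS
      rw [mem_coe, mem_filter, mem_powersetCard] at hS
      obtain ⟨⟨hSP, hc⟩, h1⟩ := hS
      obtain ⟨a, ha⟩ := card_eq_one.1 h1
      have ha' : a ∈ S ∩ M := by rw [ha]; exact mem_singleton_self a
      rw [mem_inter] at ha'
      refine ⟨(a, S.erase a), ?_, insert_erase ha'.1⟩
      rw [mem_coe, mem_product, mem_powersetCard, subset_sdiff, card_erase_of_mem ha'.1, hc]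
      refine ⟨ha'.2, ⟨(erase_subset _ _).trans hSP, ?_⟩, rfl⟩
      rw [disjoint_left]
      intro x hx hxM
      have : x ∈ S ∩ M := mem_inter.2 ⟨mem_of_mem_erase hx, hxM⟩
      rw [ha, mem_singleton] at this
      exact ne_of_mem_erase hx this
  have hsplit : {S ∈ P.powersetCard (r + 1) | #(S ∩ M) ≤ 1} =
      {S ∈ P.powersetCard (r + 1) | #(S ∩ M) = 1} ∪
        {S ∈ P.powersetCard (r + 1) | #(S ∩ M) = 0} := by
    rw [← filter_or]
    exact filter_congr fun S _ => by omega
  rw [hsplit, card_union_of_disjoint, h1, h0, card_product, card_powersetCard, card_powersetCard,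
    hU]
  exact disjoint_filter.2 fun S _ h => by omega

end Counting

/-! ### Counting mergers -/

section CycleCounts

variable {n : ℕ}

/-- Every block contains at most one element of `[m]`. -/
def SeparatesBlocks (m : ℕ) (P : Finset (Finset (Fin n))) : Prop :=
  ∀ C ∈ P, ∀ i ∈ C, ∀ j ∈ C, i.val < m → j.val < m → i = j

theorem separates_iff {m : ℕ} {σ : Perm (Fin n)} :
    Separates m σ ↔ SeparatesBlocks m (cycleSets σ) := by
  constructor
  · exact fun h C hC i hi j hj him hjm =>
      h i j him hjm (sameCycle_iff_exists_mem_cycleSets.2 ⟨C, hC, hi, hj⟩)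
  · intro h i j him hjm hij
    obtain ⟨C, hC, hi, hj⟩ := sameCycle_iff_exists_mem_cycleSets.1 hij
    exact h C hC i hi j hj him hjm

theorem numCycles_eq (σ : Perm (Fin n)) : numCycles σ = #(cycleSets σ) := by
  rw [numCycles, parts_partition_eq_map_card, Multiset.card_map]
  rfl

theorem card_cycleSets_le (σ : Perm (Fin n)) : #(cycleSets σ) ≤ n := by
  classical
  simpa [cycleSets] using card_image_le (s := (univ : Finset (Fin n)))
    (f := fun x => univ.filter fun y => σ.SameCycle x y)

/-- The cycles which contain an element of `[m]`. -/
def markedCycles (m : ℕ) (P : Finset (Finset (Fin n))) : Finset (Finset (Fin n)) :=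
  P.filter fun C => ∃ i ∈ C, i.val < m

theorem card_markedCycles {m : ℕ} (hm : m ≤ n) {σ : Perm (Fin n)}
    (h : SeparatesBlocks m (cycleSets σ)) : #(markedCycles m (cycleSets σ)) = m := by
  choose f hf hf' using exists_mem_cycleSets σ
  have h1 : #(univ.filter fun i : Fin n => i.val < m) = m := by
    rw [Fin.card_filter_val_lt]
    omega
  conv_rhs => rw [← h1]
  symm
  refine card_nbij f ?_ ?_ ?_
  · intro i hi
    rw [mem_coe, mem_filter] at hi
    rw [mem_coe, markedCycles, mem_filter]
    exact ⟨hf i, i, hf' i, hi.2⟩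
  · intro i hi j hj hij
    rw [mem_coe, mem_filter] at hi hj
    exact h (f i) (hf i) i (hf' i) j (hij ▸ hf' j) hi.2 hj.2
  · intro C hC
    rw [mem_coe, markedCycles, mem_filter] at hC
    obtain ⟨hC, i, hi, him⟩ := hC
    exact ⟨i, by simpa using him, eq_of_mem_cycleSets (hf i) hC (hf' i) hi⟩

/-- Ensures that `insert` adds a new block, so that merging `2j + 1` cycles lowers their number by
exactly `2j`. -/
theorem biUnion_notMem_sdiff {σ : Perm (Fin n)} {S : Finset (Finset (Fin n))}
    (hS : S ⊆ cycleSets σ) (hne : S.Nonempty) : S.biUnion id ∉ cycleSets σ \ S := by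
  rw [mem_sdiff]
  rintro ⟨h1, h2⟩
  obtain ⟨D, hD⟩ := hne
  obtain ⟨x, hx⟩ := (mem_cycleSets.1 (hS hD)).1
  have hxU : x ∈ S.biUnion id := mem_biUnion.2 ⟨D, hD, hx⟩
  have := eq_of_mem_cycleSets (hS hD) h1 hx hxU
  exact h2 (this ▸ hD)

/-- A union of cycles violates separation precisely if two of them are marked. One or no marked
cycle in `S` gives the two binomial terms. -/
theorem separatesBlocks_insert_iff {m : ℕ} {σ : Perm (Fin n)} {S : Finset (Finset (Fin n))}
    (hS : S ⊆ cycleSets σ) :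
    SeparatesBlocks m (insert (S.biUnion id) (cycleSets σ \ S)) ↔
      SeparatesBlocks m (cycleSets σ) ∧ #(S ∩ markedCycles m (cycleSets σ)) ≤ 1 := by
  constructor
  · intro h
    have hU := h _ (mem_insert_self _ _)
    have hsep : SeparatesBlocks m (cycleSets σ) := by
      intro C hC i hi j hj
      by_cases hCS : C ∈ S
      · exact hU i (mem_biUnion.2 ⟨C, hCS, hi⟩) j (mem_biUnion.2 ⟨C, hCS, hj⟩)
      · exact h C (mem_insert_of_mem (mem_sdiff.2 ⟨hC, hCS⟩)) i hi j hj
    refine ⟨hsep, card_le_one.2 fun C hC D hD => ?_⟩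
    rw [mem_inter, markedCycles, mem_filter] at hC hD
    obtain ⟨hCS, hC, i, hi, him⟩ := hC
    obtain ⟨hDS, hD, j, hj, hjm⟩ := hD
    have := hU i (mem_biUnion.2 ⟨C, hCS, hi⟩) j (mem_biUnion.2 ⟨D, hDS, hj⟩) him hjm
    exact eq_of_mem_cycleSets hC hD hi (this ▸ hj)
  · rintro ⟨h, h1⟩ C hC i hi j hj him hjm
    rw [mem_insert] at hC
    rcases hC with rfl | hC
    · obtain ⟨D, hD, hiD⟩ := mem_biUnion.1 hi
      obtain ⟨D', hD', hjD'⟩ := mem_biUnion.1 hj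
      have : D = D' := card_le_one.1 h1 D
        (mem_inter.2 ⟨hD, mem_filter.2 ⟨hS hD, i, hiD, him⟩⟩) D'
        (mem_inter.2 ⟨hD', mem_filter.2 ⟨hS hD', j, hjD', hjm⟩⟩)
      subst this
      exact h D (hS hD) i hiD j hjD' him hjm
    · exact h C (mem_sdiff.1 hC).1 i hi j hj him hjm

theorem card_odd_eq_sum_card {β : Type*} [DecidableEq β] {P : Finset β} {n : ℕ} (hP : #P ≤ n)
    (R : Finset β → Prop) [DecidablePred R] :
    #{S ∈ P.powerset | Odd #S ∧ R S} =
      ∑ j ∈ range (n + 1), #{S ∈ P.powersetCard (2 * j + 1) | R S} := by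
  rw [card_eq_sum_card_fiberwise (f := fun S => #S / 2) (t := range (n + 1))]
  · refine sum_congr rfl fun j _ => congrArg _ ?_
    ext S
    simp only [mem_filter, mem_powerset, mem_powersetCard, Nat.odd_iff]
    constructor
    · rintro ⟨⟨h1, h2, h3⟩, h4⟩
      exact ⟨⟨h1, by omega⟩, h3⟩
    · rintro ⟨⟨h1, h2⟩, h3⟩
      exact ⟨⟨h1, by omega, h3⟩, by omega⟩
  · intro S hS
    rw [mem_coe, mem_filter, mem_powerset] at hS
    have := card_le_card hS.1
    rw [mem_coe, mem_range]
    dsimp only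
    omega

open Classical in
theorem card_merge_separating {m k : ℕ} (hm : m ≤ n) (σ : Perm (Fin n)) :
    #{S ∈ (cycleSets σ).powerset | Odd #S ∧
        (#(insert (S.biUnion id) (cycleSets σ \ S)) = k ∧
          SeparatesBlocks m (insert (S.biUnion id) (cycleSets σ \ S)))} =
      ∑ j ∈ range (n + 1), if #(cycleSets σ) = k + 2 * j ∧ SeparatesBlocks m (cycleSets σ) then
        m * (k + 2 * j - m).choose (2 * j) + (k + 2 * j - m).choose (2 * j + 1) else 0 := by
  rw [card_odd_eq_sum_card (card_cycleSets_le σ)]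
  refine sum_congr rfl fun j _ => ?_
  have hiff : ∀ S ∈ (cycleSets σ).powersetCard (2 * j + 1),
      (#(insert (S.biUnion id) (cycleSets σ \ S)) = k ∧
          SeparatesBlocks m (insert (S.biUnion id) (cycleSets σ \ S))) ↔
      ((#(cycleSets σ) = k + 2 * j ∧ SeparatesBlocks m (cycleSets σ)) ∧
        #(S ∩ markedCycles m (cycleSets σ)) ≤ 1) := by
    intro S hS
    rw [mem_powersetCard] at hS
    have hne : S.Nonempty := card_pos.1 (by omega)
    have hle := card_le_card hS.1
    rw [separatesBlocks_insert_iff hS.1, card_insert_of_notMem (biUnion_notMem_sdiff hS.1 hne),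
      card_sdiff_of_subset hS.1, hS.2, and_assoc]
    refine and_congr_left fun _ => ?_
    omega
  rw [filter_congr hiff]
  split_ifs with h
  · simp only [h, true_and]
    have hsub : markedCycles m (cycleSets σ) ⊆ cycleSets σ := filter_subset _ _
    have := card_powersetCard_filter_inter_le_one hsub (2 * j)
    rw [card_markedCycles hm h.2, h.1] at this
    convert this
  · rw [card_eq_zero, filter_eq_empty_iff]
    exact fun S _ h' => h h'.1

/-- The number of ways of merging `r` parts of `s` so as to obtain `t`. -/
def mergeCount (r : ℕ) (s t : Multiset ℕ) : ℕ :=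
  ((s.powersetCard r).filter fun u => (s - u) + {u.sum} = t).card

open Classical in
-- Cycles of equal length stay distinguished, just as `Multiset.powersetCard` distinguishes equal
-- parts, so the count depends only on the lengths.
theorem card_merge_parts (σ : Perm (Fin n)) (t : Multiset ℕ) :
    #{S ∈ (cycleSets σ).powerset | Odd #S ∧
        (insert (S.biUnion id) (cycleSets σ \ S)).val.map Finset.card = t} =
      ∑ j ∈ range (n + 1), mergeCount (2 * j + 1) σ.partition.parts t := by
  rw [card_odd_eq_sum_card (card_cycleSets_le σ)]
  refine sum_congr rfl fun j _ => ?_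
  have hiff : ∀ S ∈ (cycleSets σ).powersetCard (2 * j + 1),
      (insert (S.biUnion id) (cycleSets σ \ S)).val.map Finset.card =
        (σ.partition.parts - S.val.map Finset.card) + {(S.val.map Finset.card).sum} := by
    intro S hS
    rw [mem_powersetCard] at hS
    have hne : S.Nonempty := card_pos.1 (by omega)
    have hU : #(S.biUnion id) = (S.val.map Finset.card).sum :=
      card_biUnion ((cycleSets_pairwiseDisjoint σ).subset hS.1)
    have hsplit : (cycleSets σ).val = (cycleSets σ \ S).val + S.val := by
      rw [← disjUnion_val _ _ sdiff_disjoint, disjUnion_eq_union, sdiff_union_of_subset hS.1]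
    rw [insert_val_of_notMem (biUnion_notMem_sdiff hS.1 hne), Multiset.map_cons, hU,
      parts_partition_eq_map_card, hsplit, Multiset.map_add, add_tsub_cancel_right,
      ← Multiset.singleton_add, add_comm]
  rw [filter_congr fun S hS => by rw [hiff S hS], mergeCount, parts_partition_eq_map_card,
    Multiset.powersetCard_map, Multiset.filter_map, Multiset.card_map]
  have hval : ((cycleSets σ).powersetCard (2 * j + 1)).val.map Finset.val =
      (cycleSets σ).val.powersetCard (2 * j + 1) := by
    rw [Finset.powersetCard, Multiset.map_pmap, Multiset.pmap_eq_map, Multiset.map_id']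
  rw [← hval, Multiset.filter_map, Multiset.card_map]
  rfl

end CycleCounts

/-! ### The recurrence -/

section Recurrence

variable {n : ℕ}

open Classical in
theorem pNum_eq_card (lam : n.Partition) (m k : ℕ) :
    pNum lam m k = #{q : Perm (Fin n) × Perm (Fin n) | (q.1 * q.2).IsCycleOn Set.univ ∧
      (cycleSets q.1).val.map Finset.card = lam.parts ∧
      (#(cycleSets q.2) = k ∧ SeparatesBlocks m (cycleSets q.2))} := by
  have hinj : Set.InjOn (fun p : PlanePermutation n => (p.diagonal, p.vertical))
      (planePermsWithType lam m k) := by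
    intro p _ q _ h
    rw [Prod.mk.injEq] at h
    refine PlanePermutation.ext ?_ h.2
    have h1 := h.1
    rw [PlanePermutation.diagonal, PlanePermutation.diagonal, h.2] at h1
    exact mul_right_cancel h1
  rw [pNum, ← hinj.ncard_image, ← Set.ncard_coe_finset]
  congr 1
  ext ⟨D, π⟩
  simp only [planePermsWithType, planePermsWithDiagonal, HasCycleType, numCycles_eq, separates_iff,
    parts_partition_eq_map_card, Set.mem_image, Set.mem_iUnion, Set.mem_ofPred_eq, coe_filter,
    mem_univ, true_and, Prod.mk.injEq, exists_prop]
  constructor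
  · rintro ⟨p, ⟨D, h1, rfl, h2⟩, rfl, rfl⟩
    refine ⟨?_, h1, h2⟩
    rw [PlanePermutation.diagonal, inv_mul_cancel_right]
    exact p.isCycleOn
  · rintro ⟨h1, h2, h3⟩
    have hD : PlanePermutation.diagonal ⟨D * π, π, h1⟩ = D := mul_inv_cancel_right D π
    exact ⟨⟨D * π, π, h1⟩, ⟨D, h2, hD, h3⟩, hD, rfl⟩

open Classical in
theorem sum_merge_parts (lam : n.Partition) (m k : ℕ) :
    ∑ q : Perm (Fin n) × Perm (Fin n) with (q.1 * q.2).IsCycleOn Set.univ ∧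
        (#(cycleSets q.2) = k ∧ SeparatesBlocks m (cycleSets q.2)),
      #{S ∈ (cycleSets q.1).powerset | Odd #S ∧
        (insert (S.biUnion id) (cycleSets q.1 \ S)).val.map Finset.card = lam.parts} =
      ∑ j ∈ range (n + 1), ∑ mu : n.Partition, kappa (2 * j + 1) mu lam * pNum mu m k := by
  simp_rw [card_merge_parts]
  rw [sum_comm]
  refine sum_congr rfl fun j _ => ?_
  let type : Perm (Fin n) × Perm (Fin n) → n.Partition := fun q =>
    ⟨q.1.partition.parts, fun h => q.1.partition.parts_pos h, by
      simpa using q.1.partition.parts_sum⟩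
  rw [← sum_fiberwise _ type]
  refine sum_congr rfl fun mu _ => ?_
  have htype : ∀ q, type q = mu ↔ (cycleSets q.1).val.map Finset.card = mu.parts := by
    intro q
    rw [← parts_partition_eq_map_card, Nat.Partition.ext_iff]
  rw [sum_congr rfl fun q hq => ?_, sum_const, smul_eq_mul, mul_comm, pNum_eq_card]
  · congr 2
    rw [filter_filter]
    refine filter_congr fun q _ => ?_
    rw [htype]
    tauto
  · have h := (htype q).1 (mem_filter.1 hq).2
    rw [parts_partition_eq_map_card, h]
    rfl

open Classical in
theorem sum_merge_separating (lam : n.Partition) {m : ℕ} (hm : m ≤ n) (k : ℕ) :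
    ∑ q : Perm (Fin n) × Perm (Fin n) with (q.1 * q.2).IsCycleOn Set.univ ∧
        (cycleSets q.1).val.map Finset.card = lam.parts,
      #{S ∈ (cycleSets q.2).powerset | Odd #S ∧
        (#(insert (S.biUnion id) (cycleSets q.2 \ S)) = k ∧
          SeparatesBlocks m (insert (S.biUnion id) (cycleSets q.2 \ S)))} =
      ∑ j ∈ range (n + 1), (m * (k + 2 * j - m).choose (2 * j) +
        (k + 2 * j - m).choose (2 * j + 1)) * pNum lam m (k + 2 * j) := by
  simp_rw [card_merge_separating hm]
  rw [sum_comm]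
  refine sum_congr rfl fun j _ => ?_
  rw [← sum_filter, sum_const, smul_eq_mul, mul_comm, pNum_eq_card, filter_filter]
  simp only [and_assoc]

theorem pNum_eq_zero_of_lt_marked (lam : n.Partition) {m k : ℕ} (hm : m ≤ n) (h : k < m) :
    pNum lam m k = 0 := by
  classical
  rw [pNum_eq_card, card_eq_zero, filter_eq_empty_iff]
  rintro q - ⟨-, -, h1, h2⟩
  have h3 := card_markedCycles hm h2
  have h4 : #(markedCycles m (cycleSets q.2)) ≤ #(cycleSets q.2) := card_filter_le _ _
  omega

/-- Merging a single part changes nothing; this is the source of `ℓ(λ)` in the denominator. -/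
theorem kappa_one (mu lam : n.Partition) :
    kappa 1 mu lam = if mu = lam then lam.parts.card else 0 := by
  unfold kappa
  rw [Multiset.powersetCard_one, Multiset.filter_map, Multiset.card_map]
  have h : ∀ a ∈ mu.parts,
      ((fun t => (mu.parts - t) + {t.sum} = lam.parts) ∘ singleton) a ↔ mu = lam := by
    intro a ha
    rw [Function.comp_apply, Multiset.sum_singleton,
      Multiset.sub_add_cancel (Multiset.singleton_le.2 ha), Nat.Partition.ext_iff]
  rw [Multiset.filter_congr h]
  split_ifs with hml
  · subst hml
    simp
  · simp [hml]

/-- Lets the sum over all partitions replace the sum restricted to `SplitsInto`. -/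
theorem splitsInto_of_kappa_ne_zero {r : ℕ} {mu lam : n.Partition} (h : kappa r mu lam ≠ 0) :
    SplitsInto r mu lam := by
  obtain ⟨t, ht⟩ := Multiset.card_pos_iff_exists_mem.1 (Nat.pos_of_ne_zero h)
  rw [Multiset.mem_filter, Multiset.mem_powersetCard] at ht
  obtain ⟨⟨hle, hc⟩, heq⟩ := ht
  refine ⟨t.sum, ?_, t, hc, rfl, ?_⟩
  · rw [← heq]
    simp
  · rw [← heq, Multiset.add_comm (_ - _) {t.sum}, Multiset.singleton_add, Multiset.erase_cons_head,
      Multiset.sub_add_cancel hle]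

/-- The recurrence without division, with the terms `j = 0` separated. -/
theorem recurrence (hn : 1 ≤ n) (lam : n.Partition) {m : ℕ} (hm : m ≤ n) (k : ℕ) :
    (n + 1) * pNum lam m k =
      (k * pNum lam m k + ∑ j ∈ Ico 1 (n + 1), (m * (k + 2 * j - m).choose (2 * j) +
        (k + 2 * j - m).choose (2 * j + 1)) * pNum lam m (k + 2 * j)) +
      (lam.parts.card * pNum lam m k + ∑ j ∈ Ico 1 (n + 1), ∑ mu : n.Partition,
        kappa (2 * j + 1) mu lam * pNum mu m k) := by
  classical
  have : Nonempty (Fin n) := ⟨⟨0, hn⟩⟩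
  have h := card_factorizations (α := Fin n) (fun P => P.val.map Finset.card = lam.parts)
    (fun P => #P = k ∧ SeparatesBlocks m P)
  have hA := sum_merge_separating lam hm k
  have hB := sum_merge_parts lam m k
  have hC := pNum_eq_card lam m k
  rw [Fintype.card_fin] at h
  have h' : (n + 1) * pNum lam m k =
      ∑ j ∈ range (n + 1), (m * (k + 2 * j - m).choose (2 * j) +
        (k + 2 * j - m).choose (2 * j + 1)) * pNum lam m (k + 2 * j) +
      ∑ j ∈ range (n + 1), ∑ mu : n.Partition, kappa (2 * j + 1) mu lam * pNum mu m k := by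
    rw [← hA, ← hB, hC]
    convert h
  rw [h', range_eq_Ico, sum_eq_sum_Ico_succ_bot (Nat.succ_pos n),
    sum_eq_sum_Ico_succ_bot (Nat.succ_pos n)]
  congr 2
  -- The weight for `j = 0` is `m + (k - m)`, which is `k` unless the subtraction truncates; in that
  -- case `pNum` vanishes.
  · simp only [mul_zero, add_zero, zero_add, Nat.choose_zero_right, Nat.choose_one_right, mul_one]
    rcases Nat.lt_or_ge k m with hkm | hkm
    · rw [pNum_eq_zero_of_lt_marked lam hm hkm, mul_zero, mul_zero]
    · rw [Nat.add_sub_cancel' hkm]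
  · simp [kappa_one]

end Recurrence

end

open Classical in
/-- The sums over `j ≥ 1` are `finsum`s: all their terms with `j > n` vanish, by
`pNum_eq_zero_of_lt` and `not_splitsInto_of_lt`. If `k + 2j < m`, then no permutation with
`k + 2j` cycles separates `[m]`, so that the truncated subtraction only meets a zero factor. -/
theorem mainTheorem8 (n : ℕ) (hn : 1 ≤ n) (lam : n.Partition) (m k : ℕ) (hm : m ≤ n)
    (hk : 0 < (n : ℤ) + 1 - (lam.parts.card : ℤ) - (k : ℤ)) :
    (pNum lam m k : ℚ) =
      ((∑ᶠ j ∈ Set.Ici (1 : ℕ),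
          ((m : ℚ) * ((k + 2 * j - m).choose (2 * j) : ℚ)
            + ((k + 2 * j - m).choose (2 * j + 1) : ℚ)) * (pNum lam m (k + 2 * j) : ℚ))
        + ∑ᶠ j ∈ Set.Ici (1 : ℕ),
            ∑ mu : n.Partition with SplitsInto (2 * j + 1) mu lam,
              (kappa (2 * j + 1) mu lam : ℚ) * (pNum mu m k : ℚ))
      / ((n : ℚ) + 1 - (lam.parts.card : ℚ) - (k : ℚ)) := by
  have hkQ : (0 : ℚ) < (n : ℚ) + 1 - (lam.parts.card : ℚ) - (k : ℚ) := by exact_mod_cast hk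
  have hsupp : ∀ f : ℕ → ℚ, (∀ j, n < j → f j = 0) →
      ∑ᶠ j ∈ Set.Ici (1 : ℕ), f j = ∑ j ∈ Finset.Ico 1 (n + 1), f j := by
    intro f hf
    refine finsum_mem_eq_sum_of_inter_support_eq f ?_
    ext j
    simp only [Set.mem_inter_iff, Set.mem_Ici, Function.mem_support, Finset.coe_Ico, Set.mem_Ico]
    refine and_congr_left fun hj => ⟨fun h1 => ⟨h1, ?_⟩, fun h1 => h1.1⟩
    by_contra hcon
    exact hj (hf j (by omega))
  have hrec := congrArg (Nat.cast (R := ℚ)) (recurrence hn lam hm k)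
  rw [eq_div_iff hkQ.ne', hsupp, hsupp]
  · have hfilter : ∀ j, ∑ mu : n.Partition with SplitsInto (2 * j + 1) mu lam,
        (kappa (2 * j + 1) mu lam : ℚ) * (pNum mu m k : ℚ) =
        ∑ mu : n.Partition, (kappa (2 * j + 1) mu lam : ℚ) * (pNum mu m k : ℚ) := by
      intro j
      refine Finset.sum_filter_of_ne fun mu _ h => splitsInto_of_kappa_ne_zero fun h0 => h ?_
      rw [h0, Nat.cast_zero, zero_mul]
    simp_rw [hfilter]
    push_cast at hrec
    linear_combination hrec
  · intro j hj
    refine Finset.sum_eq_zero fun mu hmu => ?_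
    exact absurd (Finset.mem_filter.1 hmu).2 (not_splitsInto_of_lt _ _ _ (by omega))
  · intro j hj
    rw [pNum_eq_zero_of_lt _ _ _ (by omega), Nat.cast_zero, mul_zero]
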